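/- **Setting.** Let $d\in\{2,3\}$, let $\Omega\subset\mathbb R^d$ be a bounded connected open set with boundary $\Gamma=\partial\Omega$ of class $C^2$, and let $0<T<\infty$. Put $\boldsymbol H=L^2(\Omega)\times L^2(\Gamma)$ and $\boldsymbol V=\{(z,z_\Gamma)\in H^1(\Omega)\times H^1(\Gamma): z_\Gamma=z|_\Gamma\}$, with the natural product inner products, $\boldsymbol W=H^2(\Omega)\times H^2(\Gamma)$, $m(\boldsymbol z)=\big(\int_\Omega z\,dx+\int_\Gamma z_\Gamma\,d\Gamma\big)/(|\Omega|+|\Gamma|)$, $\boldsymbol H_0=\{\boldsymbol z\in\boldsymbol H: m(\boldsymbol z)=0\}$, $\boldsymbol V_0=\boldsymbol V\cap\boldsymbol H_0$, $\boldsymbol 1=(1,1)$, and $$a(\boldsymbol u,\boldsymbol z)=\int_\Omega\nabla u\cdot\nabla z\,dx+\int_\Gamma\nabla_\Gamma u_\Gamma\cdot\nabla_\Gamma z_\Gamma\,d\Gamma,\qquad |\boldsymbol z|_{\boldsymbol V_0}=a(\boldsymbol z,\boldsymbol z)^{1/2}\quad(\boldsymbol z\in\boldsymbol V_0).$$ $|\cdot|_{\boldsymbol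 V_0^*}$ and $|\cdot|_{\boldsymbol V^*}$ are the norms dual to $|\cdot|_{\boldsymbol V_0}$ and $|\cdot|_{\boldsymbol V}$; elements of $\boldsymbol V_0$ and $\boldsymbol H$ are regarded as elements of $\boldsymbol V_0^*$ and $\boldsymbol V^*$ through $(\cdot,\cdot)_{\boldsymbol H}$. Let $c_p>0$ denote a constant such that $c_p|\boldsymbol z|_{\boldsymbol V}^2\le|\boldsymbol z|_{\boldsymbol V_0}^2$ for all $\boldsymbol z\in\boldsymbol V_0$ (such a constant exists). Let $\beta=\partial\widehat\beta$ and $\beta_\Gamma=\partial\widehat\beta_\Gamma$ be the subdifferentials of convex, lower semicontinuous functions $\widehat\beta,\widehat\beta_\Gamma:\mathbb R\to[0,+\infty]$ with $\widehat\beta(0)=\widehat\beta_\Gamma(0)=0$, and let $\pi,\pi_\Gamma:\mathbb R\to\mathbb R$ be Lipschitz continuous with constants $L$ and $L_\Gamma$. Fix $m_0\in\mathbb R$. For $\boldsymbol f=(f,f_\Gamma)\in L^2(0,T;\boldsymbol H)$ and $\boldsymbol v_0\in\boldsymbol V_0$ (that is, for the initial value $\boldsymbol u_0=\boldsymbol v_0+m_0\boldsymbol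 1\in\boldsymbol V$ with $m(\boldsymbol u_0)=m_0$), a *weak solution* is a triplet $(\boldsymbol v,\boldsymbol\mu,\boldsymbol\xi)$ with $\boldsymbol v\in H^1(0,T;\boldsymbol V_0^*)\cap L^\infty(0,T;\boldsymbol V_0)\cap L^2(0,T;\boldsymbol W)$, $\boldsymbol\mu\in L^2(0,T;\boldsymbol V)$, $\boldsymbol\xi=(\xi,\xi_\Gamma)\in L^2(0,T;\boldsymbol H)$, $\xi\in\beta(v+m_0)$ a.e. in $\Omega\times(0,T)$, $\xi_\Gamma\in\beta_\Gamma(v_\Gamma+m_0)$ a.e. on $\Gamma\times(0,T)$, such that for a.a. $t\in(0,T)$ $$\langle\boldsymbol v'(t),\boldsymbol z\rangle_{\boldsymbol V_0^*,\boldsymbol V_0}+a(\boldsymbol\mu(t),\boldsymbol z)=0\quad\text{for all }\boldsymbol z\in\boldsymbol V_0,$$ $$(\boldsymbol\mu(t),\boldsymbol z)_{\boldsymbol H}=a(\boldsymbol v(t),\boldsymbol z)+\big(\boldsymbol\xi(t)+(\pi(v(t)+m_0),\pi_\Gamma(v_\Gamma(t)+m_0))-\boldsymbol f(t),\boldsymbol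 z\big)_{\boldsymbol H}\quad\text{for all }\boldsymbol z\in\boldsymbol V,$$ and $\boldsymbol v(0)=\boldsymbol v_0$ in $\boldsymbol H_0$. (Here $\boldsymbol v$ is identified with its representative that is continuous from $[0,T]$ to $\boldsymbol V_0^*$; it takes values in $\boldsymbol V_0$.) **Theorem 2.1.** There is a constant $C>0$, depending only on $c_p$, $L$, $L_\Gamma$ and $T$, with the following property. For $i=1,2$ let $(\boldsymbol v^{(i)},\boldsymbol\mu^{(i)},\boldsymbol\xi^{(i)})$ be a weak solution corresponding to the data $\boldsymbol f^{(i)}\in L^2(0,T;\boldsymbol H)$ and $\boldsymbol v_0^{(i)}\in\boldsymbol V_0$, with the same $m_0$. Then, for all $t\in[0,T]$, $$|\boldsymbol v^{(1)}(t)-\boldsymbol v^{(2)}(t)|_{\boldsymbol V_0^*}^2+\int_0^t|\boldsymbol v^{(1)}(s)-\boldsymbol v^{(2)}(s)|_{\boldsymbol V_0}^2\,ds\le C\Big\{|\boldsymbol v_0^{(1)}-\boldsymbol v_0^{(2)}|_{\boldsymbol V_0^*}^2+\int_0^t|\boldsymbol f^{(1)}(s)-\boldsymbol f^{(2)}(s)|_{\boldsymbol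 V^*}^2\,ds\Big\}.$$ In particular, if $\boldsymbol f^{(1)}=\boldsymbol f^{(2)}$ a.e. in $(0,T)$ and $\boldsymbol v_0^{(1)}=\boldsymbol v_0^{(2)}$, then $\boldsymbol v^{(1)}(t)=\boldsymbol v^{(2)}(t)$ for all $t\in[0,T]$. -/

import Mathlib

open MeasureTheory Set
open scoped ContDiff ENNReal NNReal

namespace CahnHilliard

noncomputable section

/-! ### The domain -/

/-- The Euclidean space `ℝ^d`. -/
abbrev E (d : ℕ) : Type := EuclideanSpace ℝ (Fin d)

/-- Bounded domains (open, connected, non-empty) with boundary of class `C²`: near each boundary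
point, `Ω` is the set where a `C²` function with non-vanishing differential is negative. -/
structure IsSmoothBoundedDomain {d : ℕ} (Ω : Set (E d)) : Prop where
  isOpen : IsOpen Ω
  isConnected : IsConnected Ω
  isBounded : Bornology.IsBounded Ω
  boundary : ∀ x ∈ frontier Ω, ∃ (U : Set (E d)) (ρ : E d → ℝ), IsOpen U ∧ x ∈ U ∧
    ContDiffOn ℝ 2 ρ U ∧ (∀ y ∈ U, fderiv ℝ ρ y ≠ 0) ∧ Ω ∩ U = {y ∈ U | ρ y < 0}

/-- Lebesgue measure on `Ω`. -/
abbrev bulk {d : ℕ} (Ω : Set (E d)) : Measure (E d) := volume.restrict Ω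

/-- Surface measure on `Γ = ∂Ω`: the `(d-1)`-dimensional Hausdorff measure, normalized so as to
agree with Lebesgue measure on `(d-1)`-dimensional Euclidean spaces. -/
abbrev surf {d : ℕ} (Ω : Set (E d)) : Measure (E d) := (μHE[d - 1]).restrict (frontier Ω)

/-! ### First order Sobolev spaces

An element of `H¹` is recorded together with its gradient, as a pair `(z, ∇z)` in `L² × L²`; the
inner product inherited from `L² × L²` is the usual inner product of `H¹`. -/

/-- Pairs (function, vector field) of square integrable objects. -/
abbrev Jet {d : ℕ} (m : Measure (E d)) : Type := WithLp 2 (Lp ℝ 2 m × Lp (E d) 2 m)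

/-- `H¹(Ω)`: pairs `(z, g)` such that `g` is the weak gradient of `z` in `Ω`. -/
def H1Bulk {d : ℕ} (Ω : Set (E d)) : Submodule ℝ (Jet (bulk Ω)) where
  carrier := {p | ∀ φ : E d → ℝ, ContDiff ℝ ∞ φ → HasCompactSupport φ → tsupport φ ⊆ Ω →
    ∀ e : E d, ∫ x in Ω, p.fst x * fderiv ℝ φ x e = - ∫ x in Ω, inner ℝ (p.snd x) e * φ x}
  zero_mem' := by
    intro φ _ _ _ e
    have h1 : ∀ᵐ x ∂(bulk Ω), ((0 : Lp ℝ 2 (bulk Ω)) : E d → ℝ) x = 0 := Lp.coeFn_zero ..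
    have h2 : ∀ᵐ x ∂(bulk Ω), ((0 : Lp (E d) 2 (bulk Ω)) : E d → E d) x = 0 := Lp.coeFn_zero ..
    rw [integral_eq_zero_of_ae, integral_eq_zero_of_ae, neg_zero]
    · filter_upwards [h2] with x hx
      rw [WithLp.zero_snd, hx]
      simp
    · filter_upwards [h1] with x hx
      rw [WithLp.zero_fst, hx]
      simp
  add_mem' := by
    intro p q hp hq φ h1 h2 h3 e
    have hd : MemLp (fun x => fderiv ℝ φ x e) 2 (bulk Ω) :=
      ((h1.continuous_fderiv (by simp)).clm_apply continuous_const).memLp_of_hasCompactSupport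
        (h2.fderiv_apply (𝕜 := ℝ) e)
    have hφ : MemLp φ 2 (bulk Ω) := h1.continuous.memLp_of_hasCompactSupport h2
    have i1 : ∀ r : Lp ℝ 2 (bulk Ω), Integrable (fun x => r x * fderiv ℝ φ x e) (bulk Ω) :=
      fun r => (Lp.memLp r).integrable_mul hd
    have i2 : ∀ r : Lp (E d) 2 (bulk Ω), Integrable (fun x => inner ℝ (r x) e * φ x) (bulk Ω) :=
      fun r => ((Lp.memLp r).inner_const e).integrable_mul hφ
    have e1 : ∀ᵐ x ∂(bulk Ω), (p + q).fst x * fderiv ℝ φ x e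
        = p.fst x * fderiv ℝ φ x e + q.fst x * fderiv ℝ φ x e := by
      filter_upwards [Lp.coeFn_add p.fst q.fst] with x hx
      rw [WithLp.add_fst, hx, Pi.add_apply, add_mul]
    have e2 : ∀ᵐ x ∂(bulk Ω), inner ℝ ((p + q).snd x) e * φ x
        = inner ℝ (p.snd x) e * φ x + inner ℝ (q.snd x) e * φ x := by
      filter_upwards [Lp.coeFn_add p.snd q.snd] with x hx
      rw [WithLp.add_snd, hx, Pi.add_apply, inner_add_left, add_mul]
    rw [integral_congr_ae e1, integral_congr_ae e2, integral_add (i1 _) (i1 _),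
      integral_add (i2 _) (i2 _), hp φ h1 h2 h3 e, hq φ h1 h2 h3 e]
    ring
  smul_mem' := by
    intro c p hp φ h1 h2 h3 e
    have e1 : ∀ᵐ x ∂(bulk Ω), (c • p).fst x * fderiv ℝ φ x e
        = c * (p.fst x * fderiv ℝ φ x e) := by
      filter_upwards [Lp.coeFn_smul c p.fst] with x hx
      rw [WithLp.smul_fst, hx, Pi.smul_apply, smul_eq_mul, mul_assoc]
    have e2 : ∀ᵐ x ∂(bulk Ω), inner ℝ ((c • p).snd x) e * φ x
        = c * (inner ℝ (p.snd x) e * φ x) := by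
      filter_upwards [Lp.coeFn_smul c p.snd] with x hx
      rw [WithLp.smul_snd, hx, Pi.smul_apply, inner_smul_left, mul_assoc]
      rfl
    rw [integral_congr_ae e1, integral_congr_ae e2, integral_const_mul, integral_const_mul,
      hp φ h1 h2 h3 e]
    ring

/-- The tangent space `T_x Γ` of `Γ = ∂Ω` at `x`. -/
def tangentSpace {d : ℕ} (Ω : Set (E d)) (x : E d) : Submodule ℝ (E d) :=
  Submodule.span ℝ (tangentConeAt ℝ (frontier Ω) x)

/-- The surface gradient `∇_Γ φ (x)` of (the restriction to `Γ` of) a smooth function `φ`: the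
orthogonal projection of `∇φ(x)` onto `T_x Γ`. -/
def surfGrad {d : ℕ} (Ω : Set (E d)) (φ : E d → ℝ) (x : E d) : E d :=
  (tangentSpace Ω x).starProjection (gradient φ x)

/-- The pairs `(φ, ∇_Γ φ)` on `Γ`, with `φ` a smooth function. -/
def smoothSurfJets {d : ℕ} (Ω : Set (E d)) : Submodule ℝ (Jet (surf Ω)) where
  carrier := {p | ∃ φ : E d → ℝ, ContDiff ℝ ∞ φ ∧
    p.fst =ᵐ[surf Ω] φ ∧ p.snd =ᵐ[surf Ω] surfGrad Ω φ}
  zero_mem' := by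
    refine ⟨fun _ => 0, contDiff_const, Lp.coeFn_zero .., ?_⟩
    filter_upwards [Lp.coeFn_zero (E d) 2 (surf Ω)] with x hx
    simpa [surfGrad] using hx
  add_mem' := by
    rintro p q ⟨φ, h1, h2, h3⟩ ⟨ψ, k1, k2, k3⟩
    refine ⟨φ + ψ, h1.add k1, ?_, ?_⟩
    · filter_upwards [Lp.coeFn_add p.fst q.fst, h2, k2] with x hx hp hq
      rw [WithLp.add_fst, hx, Pi.add_apply, hp, hq, Pi.add_apply]
    · filter_upwards [Lp.coeFn_add p.snd q.snd, h3, k3] with x hx hp hq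
      have a1 : DifferentiableAt ℝ φ x := h1.differentiable (by simp) x
      have a2 : DifferentiableAt ℝ ψ x := k1.differentiable (by simp) x
      rw [WithLp.add_snd, hx, Pi.add_apply, hp, hq]
      simp only [surfGrad, gradient, fderiv_add a1 a2, map_add]
  smul_mem' := by
    rintro c p ⟨φ, h1, h2, h3⟩
    refine ⟨c • φ, contDiff_const.smul h1, ?_, ?_⟩
    · filter_upwards [Lp.coeFn_smul c p.fst, h2] with x hx hp
      rw [WithLp.smul_fst, hx, Pi.smul_apply, hp, Pi.smul_apply]
    · filter_upwards [Lp.coeFn_smul c p.snd, h3] with x hx hp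
      have a1 : DifferentiableAt ℝ φ x := h1.differentiable (by simp) x
      rw [WithLp.smul_snd, hx, Pi.smul_apply, hp]
      simp [surfGrad, gradient, fderiv_const_smul a1 c]

/-- `H¹(Γ)`: the closure of the smooth functions on `Γ` in the norm
`(|z|²_{L²(Γ)} + |∇_Γ z|²_{L²(Γ)})^{1/2}`. Its elements are the pairs `(z, ∇_Γ z)`. -/
def H1Surf {d : ℕ} (Ω : Set (E d)) : Submodule ℝ (Jet (surf Ω)) :=
  (smoothSurfJets Ω).topologicalClosure

/-- `TraceRel Ω p w`: the function `w ∈ L²(Γ)` is the trace on `Γ` of the element `p` of `H¹(Ω)`,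
that is, there are smooth functions converging to `p` in `H¹(Ω)` whose restrictions to `Γ` converge
to `w` in `L²(Γ)`. -/
def TraceRel {d : ℕ} (Ω : Set (E d)) (p : Jet (bulk Ω)) (w : Lp ℝ 2 (surf Ω)) : Prop :=
  (p, w) ∈ closure {q : Jet (bulk Ω) × Lp ℝ 2 (surf Ω) | ∃ φ : E d → ℝ, ContDiff ℝ ∞ φ ∧
    q.1.fst =ᵐ[bulk Ω] φ ∧ q.1.snd =ᵐ[bulk Ω] gradient φ ∧ q.2 =ᵐ[surf Ω] φ}

theorem traceRel_zero {d : ℕ} (Ω : Set (E d)) : TraceRel Ω 0 0 := by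
  refine subset_closure ⟨fun _ => 0, contDiff_const, Lp.coeFn_zero .., ?_, Lp.coeFn_zero ..⟩
  filter_upwards [Lp.coeFn_zero (E d) 2 (bulk Ω)] with x hx
  simpa [gradient] using hx

theorem TraceRel.add {d : ℕ} {Ω : Set (E d)} {p p' : Jet (bulk Ω)} {w w' : Lp ℝ 2 (surf Ω)}
    (h : TraceRel Ω p w) (h' : TraceRel Ω p' w') : TraceRel Ω (p + p') (w + w') := by
  refine map_mem_closure₂ (f := fun a b : Jet (bulk Ω) × Lp ℝ 2 (surf Ω) => a + b)
    continuous_add h h' ?_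
  rintro q ⟨φ, h1, h2, h3, h4⟩ r ⟨ψ, k1, k2, k3, k4⟩
  refine ⟨φ + ψ, h1.add k1, ?_, ?_, ?_⟩
  · filter_upwards [Lp.coeFn_add q.1.fst r.1.fst, h2, k2] with x hx hp hq
    rw [Prod.fst_add, WithLp.add_fst, hx, Pi.add_apply, hp, hq, Pi.add_apply]
  · filter_upwards [Lp.coeFn_add q.1.snd r.1.snd, h3, k3] with x hx hp hq
    have a1 : DifferentiableAt ℝ φ x := h1.differentiable (by simp) x
    have a2 : DifferentiableAt ℝ ψ x := k1.differentiable (by simp) x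
    rw [Prod.fst_add, WithLp.add_snd, hx, Pi.add_apply, hp, hq]
    simp only [gradient, fderiv_add a1 a2, map_add]
  · filter_upwards [Lp.coeFn_add q.2 r.2, h4, k4] with x hx hp hq
    rw [Prod.snd_add, hx, Pi.add_apply, hp, hq, Pi.add_apply]

theorem TraceRel.smul {d : ℕ} {Ω : Set (E d)} {p : Jet (bulk Ω)} {w : Lp ℝ 2 (surf Ω)} (c : ℝ)
    (h : TraceRel Ω p w) : TraceRel Ω (c • p) (c • w) := by
  refine map_mem_closure (f := fun a : Jet (bulk Ω) × Lp ℝ 2 (surf Ω) => c • a)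
    (continuous_const_smul c) h ?_
  rintro q ⟨φ, h1, h2, h3, h4⟩
  refine ⟨c • φ, contDiff_const.smul h1, ?_, ?_, ?_⟩
  · filter_upwards [Lp.coeFn_smul c q.1.fst, h2] with x hx hp
    rw [Prod.smul_fst, WithLp.smul_fst, hx, Pi.smul_apply, hp, Pi.smul_apply]
  · filter_upwards [Lp.coeFn_smul c q.1.snd, h3] with x hx hp
    have a1 : DifferentiableAt ℝ φ x := h1.differentiable (by simp) x
    rw [Prod.smul_fst, WithLp.smul_snd, hx, Pi.smul_apply, hp]
    simp [gradient, fderiv_const_smul a1 c]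
  · filter_upwards [Lp.coeFn_smul c q.2, h4] with x hx hp
    rw [Prod.smul_snd, hx, Pi.smul_apply, hp, Pi.smul_apply]

/-! ### Second order Sobolev spaces -/

/-- Second order jets `(z, ∇z, (∇(∂₁z), …, ∇(∂_d z)))` of square integrable objects. -/
abbrev Jet2 {d : ℕ} (m : Measure (E d)) : Type :=
  WithLp 2 (Jet m × PiLp 2 (fun _ : Fin d => Lp (E d) 2 m))

/-- Second order Sobolev space over a first order one: `(z, g, h)` with `(z, g) ∈ S` and
`(gᵢ, hᵢ) ∈ S` for each component `gᵢ` of the gradient `g`. For `S = H¹(Ω)` this is `H²(Ω)`, for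
`S = H¹(Γ)` this is `H²(Γ)`. -/
def H2 {d : ℕ} {m : Measure (E d)} (S : Submodule ℝ (Jet m)) : Set (Jet2 m) :=
  {q | q.fst ∈ S ∧ ∀ i : Fin d,
    WithLp.toLp 2 ((EuclideanSpace.proj i : E d →L[ℝ] ℝ).compLp q.fst.snd, q.snd i) ∈ S}

/-! ### The product spaces -/

/-- The Hilbert space `𝐇 = L²(Ω) × L²(Γ)`. -/
abbrev BoldH {d : ℕ} (Ω : Set (E d)) : Type := WithLp 2 (Lp ℝ 2 (bulk Ω) × Lp ℝ 2 (surf Ω))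

/-- Pairs of first order jets on `Ω` and on `Γ`; the space `𝐕` is a subspace of it, with the
inherited inner product. -/
abbrev Jets {d : ℕ} (Ω : Set (E d)) : Type := WithLp 2 (Jet (bulk Ω) × Jet (surf Ω))

/-- The map `((a, b), (a', b')) ↦ (a, a')`. -/
def firstParts (A B A' B' : Type*) [NormedAddCommGroup A] [NormedSpace ℝ A]
    [NormedAddCommGroup B] [NormedSpace ℝ B] [NormedAddCommGroup A'] [NormedSpace ℝ A']
    [NormedAddCommGroup B'] [NormedSpace ℝ B'] :
    WithLp 2 (WithLp 2 (A × B) × WithLp 2 (A' × B')) →L[ℝ] WithLp 2 (A × A') where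
  toFun z := WithLp.toLp 2 (z.fst.fst, z.snd.fst)
  map_add' _ _ := rfl
  map_smul' _ _ := rfl
  cont := by fun_prop

theorem firstParts_apply {A B A' B' : Type*} [NormedAddCommGroup A] [NormedSpace ℝ A]
    [NormedAddCommGroup B] [NormedSpace ℝ B] [NormedAddCommGroup A'] [NormedSpace ℝ A']
    [NormedAddCommGroup B'] [NormedSpace ℝ B'] (z : WithLp 2 (WithLp 2 (A × B) × WithLp 2 (A' × B'))) :
    (firstParts A B A' B' z).fst = z.fst.fst ∧ (firstParts A B A' B' z).snd = z.snd.fst :=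
  ⟨rfl, rfl⟩

/-- The underlying pair of functions `(z, z_Γ)`. -/
def toH {d : ℕ} (Ω : Set (E d)) : Jets Ω →L[ℝ] BoldH Ω :=
  firstParts (Lp ℝ 2 (bulk Ω)) (Lp (E d) 2 (bulk Ω)) (Lp ℝ 2 (surf Ω)) (Lp (E d) 2 (surf Ω))

theorem toH_fst {d : ℕ} (Ω : Set (E d)) (z : Jets Ω) : (toH Ω z).fst = z.fst.fst :=
  (firstParts_apply z).1

theorem toH_snd {d : ℕ} (Ω : Set (E d)) (z : Jets Ω) : (toH Ω z).snd = z.snd.fst :=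
  (firstParts_apply z).2

/-- `𝐕 = {(z, z_Γ) ∈ H¹(Ω) × H¹(Γ) : z_Γ is the trace of z}`, with the norm
`|𝐳|²_𝐕 = |z|²_{H¹(Ω)} + |z_Γ|²_{H¹(Γ)}`. -/
def BoldV {d : ℕ} (Ω : Set (E d)) : Submodule ℝ (Jets Ω) where
  carrier := {z | z.fst ∈ H1Bulk Ω ∧ z.snd ∈ H1Surf Ω ∧ TraceRel Ω z.fst z.snd.fst}
  zero_mem' := ⟨zero_mem _, zero_mem _, traceRel_zero Ω⟩
  add_mem' := fun h k => ⟨add_mem h.1 k.1, add_mem h.2.1 k.2.1, h.2.2.add k.2.2⟩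
  smul_mem' := fun c _ h =>
    ⟨Submodule.smul_mem _ c h.1, Submodule.smul_mem _ c h.2.1, h.2.2.smul c⟩

/-- The mean value `m(𝐳) = (∫_Ω z + ∫_Γ z_Γ) / (|Ω| + |Γ|)`. -/
def mean {d : ℕ} {Ω : Set (E d)} (z : BoldH Ω) : ℝ :=
  ((∫ x, z.fst x ∂(bulk Ω)) + ∫ x, z.snd x ∂(surf Ω)) /
    ((bulk Ω).real univ + (surf Ω).real univ)

/-- `𝐕₀ = {𝐳 ∈ 𝐕 : m(𝐳) = 0}`. The two integrability conditions are automatic when `Ω` and `Γ`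
have finite measure. -/
def BoldV0 {d : ℕ} (Ω : Set (E d)) : Submodule ℝ (Jets Ω) where
  carrier := {z | z ∈ BoldV Ω ∧ Integrable z.fst.fst (bulk Ω) ∧ Integrable z.snd.fst (surf Ω) ∧
    mean (toH Ω z) = 0}
  zero_mem' := by
    have h1 : ((0 : Lp ℝ 2 (bulk Ω)) : E d → ℝ) =ᵐ[bulk Ω] fun _ => (0 : ℝ) := Lp.coeFn_zero ..
    have h2 : ((0 : Lp ℝ 2 (surf Ω)) : E d → ℝ) =ᵐ[surf Ω] fun _ => (0 : ℝ) := Lp.coeFn_zero ..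
    refine ⟨zero_mem _, ?_, ?_, ?_⟩
    · rw [WithLp.zero_fst, WithLp.zero_fst]
      exact (integrable_zero _ _ _).congr h1.symm
    · rw [WithLp.zero_snd, WithLp.zero_fst]
      exact (integrable_zero _ _ _).congr h2.symm
    · rw [mean, toH_fst, toH_snd, WithLp.zero_fst, WithLp.zero_fst, WithLp.zero_snd,
        WithLp.zero_fst, integral_eq_zero_of_ae h1, integral_eq_zero_of_ae h2, add_zero, zero_div]
  add_mem' := by
    rintro p q ⟨a1, a2, a3, a4⟩ ⟨b1, b2, b3, b4⟩
    have h1 := Lp.coeFn_add p.fst.fst q.fst.fst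
    have h2 := Lp.coeFn_add p.snd.fst q.snd.fst
    refine ⟨add_mem a1 b1, ?_, ?_, ?_⟩
    · rw [WithLp.add_fst, WithLp.add_fst]
      exact (a2.add b2).congr h1.symm
    · rw [WithLp.add_snd, WithLp.add_fst]
      exact (a3.add b3).congr h2.symm
    · rw [mean, toH_fst, toH_snd] at a4 b4 ⊢
      rw [WithLp.add_fst, WithLp.add_fst, WithLp.add_snd, WithLp.add_fst, integral_congr_ae h1,
        integral_congr_ae h2, integral_add' a2 b2, integral_add' a3 b3, add_add_add_comm, add_div,
        a4, b4, add_zero]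
  smul_mem' := by
    rintro c p ⟨a1, a2, a3, a4⟩
    have h1 := Lp.coeFn_smul c p.fst.fst
    have h2 := Lp.coeFn_smul c p.snd.fst
    have k1 : ∫ x, (c • (p.fst.fst : E d → ℝ)) x ∂(bulk Ω) = c * ∫ x, p.fst.fst x ∂(bulk Ω) :=
      integral_const_mul c _
    have k2 : ∫ x, (c • (p.snd.fst : E d → ℝ)) x ∂(surf Ω) = c * ∫ x, p.snd.fst x ∂(surf Ω) :=
      integral_const_mul c _
    refine ⟨Submodule.smul_mem _ c a1, ?_, ?_, ?_⟩
    · rw [WithLp.smul_fst, WithLp.smul_fst]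
      exact (a2.smul c).congr h1.symm
    · rw [WithLp.smul_snd, WithLp.smul_fst]
      exact (a3.smul c).congr h2.symm
    · rw [mean, toH_fst, toH_snd] at a4 ⊢
      rw [WithLp.smul_fst, WithLp.smul_fst, WithLp.smul_snd, WithLp.smul_fst,
        integral_congr_ae h1, integral_congr_ae h2, k1, k2, ← mul_add, mul_div_assoc, a4, mul_zero]

/-- The bilinear form `a(𝐮, 𝐳) = ∫_Ω ∇u·∇z + ∫_Γ ∇_Γ u_Γ·∇_Γ z_Γ`. -/
def aForm {d : ℕ} {Ω : Set (E d)} (u z : Jets Ω) : ℝ :=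
  (∫ x, inner ℝ (u.fst.snd x) (z.fst.snd x) ∂(bulk Ω)) +
    ∫ x, inner ℝ (u.snd.snd x) (z.snd.snd x) ∂(surf Ω)

/-- The norm `|𝐳|_{𝐕₀} = a(𝐳, 𝐳)^{1/2}`. -/
def normV0 {d : ℕ} {Ω : Set (E d)} (z : BoldV0 Ω) : ℝ :=
  Real.sqrt (aForm (z : Jets Ω) (z : Jets Ω))

/-- `c > 0` is a Poincaré constant of `Ω`: `c |𝐳|²_𝐕 ≤ |𝐳|²_{𝐕₀}` for all `𝐳 ∈ 𝐕₀`. -/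
def IsPoincareConst {d : ℕ} (Ω : Set (E d)) (c : ℝ) : Prop :=
  0 < c ∧ ∀ z : BoldV0 Ω, c * ‖z‖ ^ 2 ≤ normV0 z ^ 2

/-! ### Dual spaces -/

/-- The embedding `𝐇 ⊂ 𝐕*`, `⟨𝐠, 𝐳⟩ = (𝐠, 𝐳)_𝐇`. The operator norm of `StrongDual ℝ (BoldV Ω)` is
the norm of `𝐕*`. -/
def hToVDual {d : ℕ} {Ω : Set (E d)} (g : BoldH Ω) : StrongDual ℝ (BoldV Ω) :=
  (innerSL ℝ g).comp ((toH Ω).comp (BoldV Ω).subtypeL)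

/-- The embedding `𝐕₀ ⊂ 𝐕₀*`, `⟨𝐯, 𝐳⟩ = (𝐯, 𝐳)_𝐇`. -/
def toV0Dual {d : ℕ} {Ω : Set (E d)} (v : BoldV0 Ω) : StrongDual ℝ (BoldV0 Ω) :=
  (innerSL ℝ (toH Ω v)).comp ((toH Ω).comp (BoldV0 Ω).subtypeL)

/-- The norm of `𝐕₀*` dual to `|·|_{𝐕₀}`. By the Poincaré inequality it is equivalent to the
operator norm of `StrongDual ℝ (BoldV0 Ω)`, where `BoldV0 Ω` carries the norm of `𝐕`. -/
def normV0Dual {d : ℕ} {Ω : Set (E d)} (l : StrongDual ℝ (BoldV0 Ω)) : ℝ≥0∞ :=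
  ⨆ (z : BoldV0 Ω) (_ : normV0 z ≤ 1), ‖l z‖ₑ

/-! ### Nonlinearities and weak solutions -/

/-- The potentials `ℝ → [0, +∞]` that are convex, lower semicontinuous and vanish at `0` (hence are
proper). -/
structure IsConvexPotential (b : ℝ → ℝ≥0∞) : Prop where
  convex : ∀ r s c c' : ℝ, 0 ≤ c → 0 ≤ c' → c + c' = 1 →
    b (c * r + c' * s) ≤ ENNReal.ofReal c * b r + ENNReal.ofReal c' * b s
  lsc : LowerSemicontinuous b
  zero : b 0 = 0

/-- The subdifferential of `b : ℝ → [0, +∞]`, as a (multivalued) graph. -/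
def subdiff (b : ℝ → ℝ≥0∞) (r : ℝ) : Set ℝ :=
  {y | b r ≠ ⊤ ∧ ∀ s, b s ≠ ⊤ → (b r).toReal + y * (s - r) ≤ (b s).toReal}

/-- Weak solutions `(𝐯, 𝛍, 𝛏)` on `(0, T)` of the Cahn–Hilliard system with dynamic boundary
conditions of Cahn–Hilliard type, for the source term `f`, the mean value `m₀` and the initial
value `v₀ ∈ 𝐕₀`, i.e. `𝐮₀ = 𝐯₀ + m₀ 𝟏`. The function `v` stands for its representative that is
continuous with values in `𝐕₀*` on `[0, T]`. -/
structure IsWeakSolution {d : ℕ} (Ω : Set (E d)) (T : ℝ) (β βΓ : ℝ → Set ℝ) (π πΓ : ℝ → ℝ)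
    (f : ℝ → BoldH Ω) (m₀ : ℝ) (v₀ : BoldV0 Ω)
    (v : ℝ → BoldV0 Ω) (μ : ℝ → BoldV Ω) (ξ : ℝ → BoldH Ω) : Prop where
  /-- `𝐯 ∈ L^∞(0,T;𝐕₀)` -/
  v_memLp : MemLp v ⊤ (volume.restrict (Ioo 0 T))
  /-- `𝐯 ∈ L²(0,T;H²(Ω) × H²(Γ))` -/
  v_H2 : ∃ w : ℝ → Jet2 (bulk Ω) × Jet2 (surf Ω), MemLp w 2 (volume.restrict (Ioo 0 T)) ∧
    ∀ᵐ t ∂(volume.restrict (Ioo 0 T)), (w t).1 ∈ H2 (H1Bulk Ω) ∧ (w t).2 ∈ H2 (H1Surf Ω) ∧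
      (w t).1.fst.fst = (v t : Jets Ω).fst.fst ∧ (w t).2.fst.fst = (v t : Jets Ω).snd.fst
  /-- `𝛍 ∈ L²(0,T;𝐕)` -/
  μ_memLp : MemLp μ 2 (volume.restrict (Ioo 0 T))
  /-- `𝛏 ∈ L²(0,T;𝐇)` -/
  ξ_memLp : MemLp ξ 2 (volume.restrict (Ioo 0 T))
  /-- `ξ ∈ β(v + m₀)` a.e. in `Ω × (0,T)` -/
  ξ_bulk : ∀ᵐ t ∂(volume.restrict (Ioo 0 T)), ∀ᵐ x ∂(bulk Ω),
    (ξ t).fst x ∈ β ((v t : Jets Ω).fst.fst x + m₀)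
  /-- `ξ_Γ ∈ β_Γ(v_Γ + m₀)` a.e. on `Γ × (0,T)` -/
  ξ_surf : ∀ᵐ t ∂(volume.restrict (Ioo 0 T)), ∀ᵐ x ∂(surf Ω),
    (ξ t).snd x ∈ βΓ ((v t : Jets Ω).snd.fst x + m₀)
  /-- `𝐯 ∈ H¹(0,T;𝐕₀*)` with derivative `𝐯' = v'`, and `⟨𝐯'(t), 𝐳⟩ + a(𝛍(t), 𝐳) = 0` for all
  `𝐳 ∈ 𝐕₀`, for a.a. `t` -/
  eq_one : ∃ v' : ℝ → StrongDual ℝ (BoldV0 Ω), MemLp v' 2 (volume.restrict (Ioo 0 T)) ∧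
    (∀ t ∈ Icc 0 T, toV0Dual (v t) = toV0Dual (v 0) + ∫ s in (0 : ℝ)..t, v' s) ∧
    ∀ᵐ t ∂(volume.restrict (Ioo 0 T)), ∀ z : BoldV0 Ω,
      v' t z + aForm (μ t : Jets Ω) (z : Jets Ω) = 0
  /-- `(𝛍(t), 𝐳)_𝐇 = a(𝐯(t), 𝐳) + (𝛏(t) + 𝛑(𝐯(t) + m₀𝟏) - 𝐟(t), 𝐳)_𝐇` for all `𝐳 ∈ 𝐕`, for
  a.a. `t` -/
  eq_two : ∀ᵐ t ∂(volume.restrict (Ioo 0 T)), ∀ z : BoldV Ω,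
    inner ℝ (toH Ω (μ t)) (toH Ω z) = aForm (v t : Jets Ω) (z : Jets Ω) +
      ((∫ x, ((ξ t).fst x + π ((v t : Jets Ω).fst.fst x + m₀) - (f t).fst x)
          * (z : Jets Ω).fst.fst x ∂(bulk Ω)) +
        ∫ x, ((ξ t).snd x + πΓ ((v t : Jets Ω).snd.fst x + m₀) - (f t).snd x)
          * (z : Jets Ω).snd.fst x ∂(surf Ω))
  /-- `𝐯(0) = 𝐯₀` in `𝐇₀` -/
  init : toH Ω (v 0) = toH Ω v₀

end

end CahnHilliard

/-!
Let `v`, `μ`, `f` be the differences of the two solutions, chemical potentials and sources. The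
estimate is the standard energy argument: test the first equation with the solution of the
stationary problem with right-hand side `v`, the second one with `v` itself.

The stationary problem is solved in the space `GradSpace Ω` of pairs of square integrable vector
fields: `g` represents a functional `l` on `𝐕₀` if `l z = ⟪g, ∇z⟫` for all `z`, and a functional of
finite `𝐕₀*` norm has a representative of at most that norm (`exists_inner_toGrad_eq`). This uses
only the Hahn–Banach theorem on the range of the gradient, so neither the completeness of `𝐕₀` nor
the injectivity of the gradient is required. If `g₀` represents the initial value of `v`, then
the first equation says that `g(t) = g₀ - ∫₀ᵗ ∇μ` represents `v(t)`. Hence `(d/dt)|g|² = -2⟪∇μ, g⟫`,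
and `⟪∇μ, g⟫ = (μ, v)_𝐇`, because `μ` minus its mean value is an admissible test function
(`inner_toGrad_eq_of_forall`). By the second equation, the monotonicity of the subdifferentials and
the Lipschitz continuity of the perturbations (`IsWeakSolution.ae_norm_toGrad_sq_le`),
`|∇v|² ≤ (μ, v)_𝐇 + max(L, L_Γ) |v|²_𝐇 + (f, v)_𝐇`. Since `|v|²_𝐇 = ⟪g, ∇v⟫ ≤ |g| |∇v|`, Young's
inequality and Grönwall's lemma give the estimate (`norm_sq_add_integral_le_exp_mul`).

The Poincaré constant enters only through the term `(f, v)_𝐇`. For equal data this term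
vanishes, so that uniqueness holds without it: `g = 0` and then `|v|²_𝐇 = ⟪g, ∇v⟫ = 0`.

Constants belong to `𝐕` because the surface measure of `Γ` is finite: locally `Γ` lies in a level
set of a function with non-vanishing differential, and the projection of such a set onto the
tangent hyperplane is bi-Lipschitz (`finiteAtFilter_frontier`).
-/

namespace CahnHilliard

/-! ### Absolutely continuous curves in a Hilbert space -/

section Hilbert

/-- Absolute continuity passes from `f` to every function whose increments are dominated by a
multiple of those of `f`. -/
theorem absolutelyContinuousOnInterval_of_dist_le {X Y : Type*} [PseudoMetricSpace X]
    [PseudoMetricSpace Y] {f : ℝ → X} {g : ℝ → Y} {a b K : ℝ}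
    (hf : AbsolutelyContinuousOnInterval f a b)
    (h : ∀ x ∈ uIcc a b, ∀ y ∈ uIcc a b, dist (g x) (g y) ≤ K * dist (f x) (f y)) :
    AbsolutelyContinuousOnInterval g a b := by
  have hf' := Filter.Tendsto.const_mul K hf
  rw [mul_zero] at hf'
  refine squeeze_zero' (Filter.Eventually.of_forall fun _ =>
    Finset.sum_nonneg fun _ _ => dist_nonneg) ?_ hf'
  filter_upwards [Filter.mem_inf_of_right (Filter.mem_principal_self _)] with I hI
  rw [Finset.mul_sum]
  exact Finset.sum_le_sum fun i hi => h _ (hI.1 i hi).1 _ (hI.1 i hi).2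

variable {G : Type*} [NormedAddCommGroup G] [InnerProductSpace ℝ G]

theorem continuousOn_sub_integral {t : ℝ} {g₀ : G} {w : ℝ → G}
    (hw : IntervalIntegrable w volume 0 t) :
    ContinuousOn (fun s => g₀ - ∫ r in (0 : ℝ)..s, w r) (uIcc 0 t) :=
  continuousOn_const.sub (intervalIntegral.continuousOn_primitive_interval' hw left_mem_uIcc)

/-- The squared norm of a primitive of an integrable curve is absolutely continuous. -/
theorem absolutelyContinuousOnInterval_norm_sq {t : ℝ} {g₀ : G} {w : ℝ → G}
    (hw : IntervalIntegrable w volume 0 t) :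
    AbsolutelyContinuousOnInterval (fun s => ‖g₀ - ∫ r in (0 : ℝ)..s, w r‖ ^ 2) 0 t := by
  obtain ⟨M, hM⟩ := isCompact_uIcc.exists_bound_of_continuousOn
    (continuousOn_sub_integral (g₀ := g₀) hw)
  have hV := hw.norm.absolutelyContinuousOnInterval_intervalIntegral (c := 0) left_mem_uIcc
  refine absolutelyContinuousOnInterval_of_dist_le (K := 2 * M) hV fun x hx y hy => ?_
  have hx' := hw.mono_set (uIcc_subset_uIcc left_mem_uIcc hx)
  have hy' := hw.mono_set (uIcc_subset_uIcc left_mem_uIcc hy)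
  have e1 : ‖(g₀ - ∫ r in (0 : ℝ)..x, w r) - (g₀ - ∫ r in (0 : ℝ)..y, w r)‖
      ≤ |(∫ r in (0 : ℝ)..x, ‖w r‖) - ∫ r in (0 : ℝ)..y, ‖w r‖| := by
    rw [sub_sub_sub_cancel_left, intervalIntegral.integral_interval_sub_left hy' hx',
      intervalIntegral.integral_interval_sub_left hx'.norm hy'.norm,
      intervalIntegral.integral_symm y x, norm_neg]
    exact intervalIntegral.norm_integral_le_abs_integral_norm
  rw [Real.dist_eq, Real.dist_eq, sq_sub_sq, abs_mul]
  refine mul_le_mul ?_ ((abs_norm_sub_norm_le _ _).trans e1) (abs_nonneg _) ?_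
  · rw [abs_of_nonneg (by positivity)]
    linarith [hM x hx, hM y hy]
  · linarith [(norm_nonneg _).trans (hM x hx)]

variable [CompleteSpace G]

/-- An energy balance `(d/ds) |g|² + p ≤ K |g|² + q` along `g(s) = g₀ - ∫₀ˢ w`, integrated in time
with Grönwall's lemma. -/
theorem norm_sq_add_integral_le_exp_mul {t K : ℝ} (ht : 0 ≤ t) (hK : 0 ≤ K) {g₀ : G} {w : ℝ → G}
    (hw : IntervalIntegrable w volume 0 t) {p q : ℝ → ℝ} (hp : IntervalIntegrable p volume 0 t)
    (hq : IntervalIntegrable q volume 0 t) (hp0 : ∀ s, 0 ≤ p s) (hq0 : ∀ s, 0 ≤ q s)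
    (H : ∀ᵐ s, s ∈ Ioo 0 t → p s - 2 * inner ℝ (w s) (g₀ - ∫ r in (0 : ℝ)..s, w r)
      ≤ K * ‖g₀ - ∫ r in (0 : ℝ)..s, w r‖ ^ 2 + q s) :
    ‖g₀ - ∫ r in (0 : ℝ)..t, w r‖ ^ 2 + ∫ s in (0 : ℝ)..t, p s
      ≤ Real.exp (K * t) * (‖g₀‖ ^ 2 + ∫ s in (0 : ℝ)..t, q s) := by
  set g : ℝ → G := fun s => g₀ - ∫ r in (0 : ℝ)..s, w r with hg
  have hgc : ContinuousOn g (Icc 0 t) := by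
    rw [← uIcc_of_le ht]; exact continuousOn_sub_integral hw
  have huc : ContinuousOn (fun s => ‖g s‖ ^ 2) (Icc 0 t) := hgc.norm.pow 2
  have sub : ∀ s ∈ Icc 0 t, uIcc 0 s ⊆ uIcc 0 t := fun s hs =>
    uIcc_subset_uIcc left_mem_uIcc (by rwa [uIcc_of_le ht])
  have hui : IntervalIntegrable (fun s => ‖g s‖ ^ 2) volume 0 t :=
    ContinuousOn.intervalIntegrable (by rwa [uIcc_of_le ht])
  have hder : ∀ᵐ s, s ∈ Icc 0 t → HasDerivAt (fun s => ‖g s‖ ^ 2) (2 * inner ℝ (g s) (-w s)) s := by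
    filter_upwards [hw.ae_hasDerivAt_integral] with s hs h's
    rw [uIcc_of_le ht] at hs
    exact ((hs h's 0 ⟨le_rfl, ht⟩).const_sub g₀).norm_sq
  have hne : ∀ a : ℝ, ∀ᵐ s : ℝ, s ≠ a := fun a => by simp [ae_iff, measure_singleton]
  set A := ‖g₀‖ ^ 2 + ∫ s in (0 : ℝ)..t, q s with hA
  have key : ∀ s ∈ Icc 0 t, ‖g s‖ ^ 2 + (∫ r in (0 : ℝ)..s, p r)
      ≤ A + K * ∫ r in (0 : ℝ)..s, ‖g r‖ ^ 2 := by
    intro s hs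
    have hac := absolutelyContinuousOnInterval_norm_sq (g₀ := g₀) (hw.mono_set (sub s hs))
    have e1 := hac.integral_deriv_eq_sub
    have e2 : (∫ r in (0 : ℝ)..s, deriv (fun s => ‖g s‖ ^ 2) r)
        ≤ ∫ r in (0 : ℝ)..s, (K * ‖g r‖ ^ 2 + q r - p r) := by
      refine intervalIntegral.integral_mono_ae_restrict hs.1 hac.intervalIntegrable_deriv
        ((((hui.const_mul K).add hq).sub hp).mono_set (sub s hs)) ?_
      rw [Filter.EventuallyLE, ae_restrict_iff' measurableSet_Icc]
      filter_upwards [H, hder, hne 0, hne t] with r h1 h2 h3 h4 hr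
      have hr1 : r ∈ Icc 0 t := ⟨hr.1, hr.2.trans hs.2⟩
      rw [(h2 hr1).deriv, inner_neg_right, real_inner_comm]
      have := h1 ⟨lt_of_le_of_ne hr1.1 (Ne.symm h3), lt_of_le_of_ne hr1.2 h4⟩
      change p r - 2 * inner ℝ (w r) (g r) ≤ K * ‖g r‖ ^ 2 + q r at this
      linarith
    have e3 : (∫ r in (0 : ℝ)..s, (K * ‖g r‖ ^ 2 + q r - p r))
        = K * (∫ r in (0 : ℝ)..s, ‖g r‖ ^ 2) + (∫ r in (0 : ℝ)..s, q r)
          - ∫ r in (0 : ℝ)..s, p r := by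
      rw [intervalIntegral.integral_sub (((hui.const_mul K).add hq).mono_set (sub s hs))
        (hp.mono_set (sub s hs)), intervalIntegral.integral_add
        ((hui.const_mul K).mono_set (sub s hs)) (hq.mono_set (sub s hs)),
        intervalIntegral.integral_const_mul]
    have e4 : (∫ r in (0 : ℝ)..s, q r) ≤ ∫ r in (0 : ℝ)..t, q r :=
      intervalIntegral.integral_mono_interval le_rfl hs.1 hs.2
        (Filter.Eventually.of_forall hq0) hq
    change (∫ r in (0 : ℝ)..s, deriv (fun s => ‖g s‖ ^ 2) r) = ‖g s‖ ^ 2 - _ at e1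
    simp only [intervalIntegral.integral_same, sub_zero] at e1
    linarith
  -- Grönwall's lemma for the right-hand side of `key`, whose derivative is `K ‖g‖²`
  have hY : ContinuousOn (fun s => A + K * ∫ r in (0 : ℝ)..s, ‖g r‖ ^ 2) (Icc 0 t) := by
    have := intervalIntegral.continuousOn_primitive_interval' hui left_mem_uIcc
    rw [uIcc_of_le ht] at this
    exact continuousOn_const.add (continuousOn_const.mul this)
  have hY' : ∀ s ∈ Ico 0 t, HasDerivWithinAt (fun s => A + K * ∫ r in (0 : ℝ)..s, ‖g r‖ ^ 2)
      (K * ‖g s‖ ^ 2) (Ici s) s := by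
    intro s hs
    have hmem : Icc 0 t ∈ nhdsWithin s (Ioi s) :=
      Filter.mem_of_superset (Ioo_mem_nhdsGT hs.2) fun x hx => ⟨hs.1.trans hx.1.le, hx.2.le⟩
    refine ((intervalIntegral.integral_hasDerivWithinAt_right
      (hui.mono_set (sub s ⟨hs.1, hs.2.le⟩)) ?_ ?_).const_mul K).const_add A
    · exact ⟨Icc 0 t, hmem, huc.aestronglyMeasurable measurableSet_Icc⟩
    · exact (huc s ⟨hs.1, hs.2.le⟩).mono_of_mem_nhdsWithin hmem
  have hA0 : 0 ≤ A := add_nonneg (by positivity)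
    (intervalIntegral.integral_nonneg ht fun s _ => hq0 s)
  have hY0 : ∀ s ∈ Icc 0 t, 0 ≤ A + K * ∫ r in (0 : ℝ)..s, ‖g r‖ ^ 2 := fun s hs =>
    add_nonneg hA0 (mul_nonneg hK (intervalIntegral.integral_nonneg hs.1 fun _ _ => by positivity))
  have hgr := norm_le_gronwallBound_of_norm_deriv_right_le (δ := A) (K := K) (ε := 0) hY hY'
    (by simp [abs_of_nonneg hA0]) (fun s hs => by
      have h1 := key s ⟨hs.1, hs.2.le⟩
      have h2 : 0 ≤ ∫ r in (0 : ℝ)..s, p r := intervalIntegral.integral_nonneg hs.1 fun r _ => hp0 r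
      rw [Real.norm_of_nonneg (by positivity), Real.norm_of_nonneg (hY0 s ⟨hs.1, hs.2.le⟩),
        add_zero]
      exact mul_le_mul_of_nonneg_left (by linarith) hK) t ⟨ht, le_rfl⟩
  rw [gronwallBound_ε0, sub_zero, Real.norm_of_nonneg (hY0 t ⟨ht, le_rfl⟩)] at hgr
  rw [mul_comm (Real.exp _)]
  exact (key t ⟨ht, le_rfl⟩).trans hgr

/-! ### Riesz representation relative to a linear map -/

/-- A linear functional bounded by `M ‖A z‖` is `z ↦ ⟪g, A z⟫` for some `g` with `‖g‖ ≤ M`: it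
factors through the range of `A`, and one takes a Hahn–Banach extension of the factor. No
completeness or injectivity is needed. -/
theorem exists_inner_eq_of_le_norm {X : Type*} [AddCommGroup X] [Module ℝ X] (A : X →ₗ[ℝ] G)
    (l : X →ₗ[ℝ] ℝ) {M : ℝ} (hM : 0 ≤ M) (h : ∀ z, |l z| ≤ M * ‖A z‖) :
    ∃ g : G, ‖g‖ ≤ M ∧ ∀ z, l z = inner ℝ g (A z) := by
  obtain ⟨r, hr⟩ := A.rangeRestrict.exists_rightInverse_of_surjective A.range_rangeRestrict
  have hAr : ∀ y : LinearMap.range A, A (r y) = y := fun y =>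
    congrArg Subtype.val (LinearMap.congr_fun hr y)
  -- `l` vanishes on the kernel of `A`, so the choice of the right inverse `r` is immaterial
  let f : StrongDual ℝ (LinearMap.range A) := (l.comp r).mkContinuous M fun y => by
    simpa [hAr] using h (r y)
  obtain ⟨F, hF, hFn⟩ := exists_extension_norm_eq (LinearMap.range A) f
  refine ⟨(InnerProductSpace.toDual ℝ G).symm F, ?_, fun z => ?_⟩
  · rw [LinearIsometryEquiv.norm_map, hFn]
    exact LinearMap.mkContinuous_norm_le _ hM _
  · rw [InnerProductSpace.toDual_symm_apply]
    have h1 : F (A z) = l (r ⟨A z, z, rfl⟩) := hF ⟨A z, z, rfl⟩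
    have h2 : |l (z - r ⟨A z, z, rfl⟩)| ≤ 0 := by
      refine (h _).trans_eq ?_
      rw [map_sub, hAr, sub_self, norm_zero, mul_zero]
    rw [h1, ← sub_eq_zero, ← map_sub]
    exact abs_nonpos_iff.mp h2

end Hilbert

/-! ### The measures of the domain and of its boundary are finite -/

variable {d : ℕ} {Ω : Set (E d)}

/-- If the orthogonal projection onto a `k`-dimensional subspace distorts the distances in a bounded
set `S` by at most a factor, then `S` has finite `k`-dimensional Hausdorff measure. -/
theorem euclideanHausdorffMeasure_lt_top_of_proj {F : Type*} [NormedAddCommGroup F]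
    [InnerProductSpace ℝ F] [FiniteDimensional ℝ F] [MeasurableSpace F] [BorelSpace F]
    (W : Submodule ℝ F) {S : Set F} {K : ℝ≥0} (hS : Bornology.IsBounded S)
    (h : ∀ y ∈ S, ∀ z ∈ S, ‖y - z‖ ≤ K * ‖W.orthogonalProjectionOnto (y - z)‖) :
    (μHE[Module.finrank ℝ W] : Measure F) S < ⊤ := by
  let f : S → W := fun y => W.orthogonalProjectionOnto (y : F)
  have hf : AntilipschitzWith K f := AntilipschitzWith.of_le_mul_dist fun y z => by
    rw [Subtype.dist_eq, dist_eq_norm, dist_eq_norm, ← map_sub]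
    exact h y y.2 z z.2
  have h1 := hf.le_hausdorffMeasure_image (Nat.cast_nonneg (Module.finrank ℝ W)) univ
  have h2 : (μH[(Module.finrank ℝ W : ℕ)] : Measure F) S
      = (μH[(Module.finrank ℝ W : ℕ)] : Measure S) univ := by
    rw [← isometry_subtype_coe.hausdorffMeasure_image (Or.inl (Nat.cast_nonneg _)) univ,
      image_univ, Subtype.range_coe]
  have h3 : Bornology.IsBounded (f '' univ) := by
    refine (W.orthogonalProjectionOnto.lipschitz.isBounded_image hS).subset ?_
    rintro _ ⟨y, -, rfl⟩
    exact ⟨y, y.2, rfl⟩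
  have h4 : (μH[(Module.finrank ℝ W : ℕ)] : Measure W) (f '' univ) < ⊤ := h3.measure_lt_top
  rw [Measure.euclideanHausdorffMeasure_def, Measure.smul_apply, h2, ENNReal.smul_def, smul_eq_mul]
  refine ENNReal.mul_lt_top ENNReal.coe_lt_top (h1.trans_lt (ENNReal.mul_lt_top ?_ h4))
  exact ENNReal.rpow_lt_top_of_nonneg (Nat.cast_nonneg _) ENNReal.coe_ne_top

/-- Near a boundary point the boundary lies in a level set `{ρ = 0}`, on which the projection onto
the hyperplane orthogonal to `∇ρ` is bi-Lipschitz. -/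
theorem finiteAtFilter_frontier (hΩ : IsSmoothBoundedDomain Ω) {x : E d}
    (hx : x ∈ frontier Ω) :
    (μHE[d - 1] : Measure (E d)).FiniteAtFilter (nhdsWithin x (frontier Ω)) := by
  obtain ⟨U, ρ, hU, hxU, hρ, hρ', hΩU⟩ := hΩ.boundary x hx
  have hρx : ContDiffAt ℝ 2 ρ x := hρ.contDiffAt (hU.mem_nhds hxU)
  have hst : HasStrictFDerivAt ρ (fderiv ℝ ρ x) x := hρx.hasStrictFDerivAt (by norm_num)
  have hcont : ContinuousOn ρ U := hρ.continuousOn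
  -- boundary points are limits of points with `ρ < 0`, but do not lie in the open set `Ω`
  have hzero : ∀ y ∈ frontier Ω ∩ U, ρ y = 0 := by
    rintro y ⟨hy, hyU⟩
    refine le_antisymm ?_ ?_
    · refine le_of_not_gt fun hpos => ?_
      have hn : {z | z ∈ U ∧ 0 < ρ z} ∈ nhds y :=
        Filter.inter_mem (hU.mem_nhds hyU)
          ((hcont.continuousAt (hU.mem_nhds hyU)).eventually (lt_mem_nhds hpos))
      obtain ⟨z, ⟨hzU, hz⟩, hzΩ⟩ := mem_closure_iff_nhds.mp (frontier_subset_closure hy) _ hn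
      have : z ∈ {y ∈ U | ρ y < 0} := hΩU ▸ ⟨hzΩ, hzU⟩
      exact absurd this.2 (not_lt.mpr hz.le)
    · refine le_of_not_gt fun hneg => ?_
      have : y ∈ Ω ∩ U := hΩU ▸ ⟨hyU, hneg⟩
      rw [hΩ.isOpen.frontier_eq] at hy
      exact hy.2 this.1
  set n := (InnerProductSpace.toDual ℝ (E d)).symm (fderiv ℝ ρ x) with hn
  have hn0 : n ≠ 0 := fun h => hρ' x hxU (by simpa [hn] using h)
  have hnin : ∀ y, inner ℝ n y = fderiv ℝ ρ x y := fun y =>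
    InnerProductSpace.toDual_symm_apply
  have hnpos : 0 < ‖n‖ := norm_pos_iff.mpr hn0
  -- strict differentiability: chords of the level set make a small angle with `nᗮ`
  have hlo := (hasStrictFDerivAt_iff_isLittleO.mp hst).def (half_pos hnpos)
  rw [nhds_prod_eq] at hlo
  obtain ⟨N, hN, hNest⟩ := Filter.mem_prod_self_iff.mp hlo
  set S := frontier Ω ∩ (N ∩ U ∩ Metric.ball x 1) with hS
  refine ⟨S, Filter.inter_mem self_mem_nhdsWithin (mem_nhdsWithin_of_mem_nhds
    (Filter.inter_mem (Filter.inter_mem hN (hU.mem_nhds hxU)) (Metric.ball_mem_nhds x one_pos))), ?_⟩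
  have hrank : Module.finrank ℝ (ℝ ∙ n)ᗮ = d - 1 := by
    -- `n ≠ 0` forces `d ≠ 0`, so the subtraction is not truncated
    have h1 := Submodule.finrank_add_finrank_orthogonal (ℝ ∙ n)
    rw [finrank_span_singleton hn0, finrank_euclideanSpace_fin] at h1
    omega
  rw [← hrank]
  refine euclideanHausdorffMeasure_lt_top_of_proj (K := 2) _
    (Metric.isBounded_ball.subset fun y hy => hy.2.2) ?_
  intro y hy z hz
  have hyz : ‖ρ y - ρ z - fderiv ℝ ρ x (y - z)‖ ≤ ‖n‖ / 2 * ‖y - z‖ :=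
    hNest (mk_mem_prod hy.2.1.1 hz.2.1.1)
  simp only [hzero y ⟨hy.1, hy.2.1.2⟩, hzero z ⟨hz.1, hz.2.1.2⟩, sub_self, zero_sub, norm_neg,
    ← hnin] at hyz
  have e1 : ‖(ℝ ∙ n).starProjection (y - z)‖ ≤ 1 / 2 * ‖y - z‖ := by
    rw [Submodule.starProjection_singleton, norm_smul, norm_div]
    simp only [RCLike.ofReal_real_eq_id, id_eq, norm_pow, norm_norm]
    rw [div_mul_eq_mul_div, div_le_iff₀ (by positivity)]
    nlinarith
  have e2 : y - z = (ℝ ∙ n).starProjection (y - z) + (ℝ ∙ n)ᗮ.starProjection (y - z) := by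
    simp
  have e3 : ‖y - z‖ ≤ ‖(ℝ ∙ n).starProjection (y - z)‖ + ‖(ℝ ∙ n)ᗮ.starProjection (y - z)‖ :=
    (congrArg norm e2).trans_le (norm_add_le _ _)
  have e4 : ‖(ℝ ∙ n)ᗮ.starProjection (y - z)‖ = ‖(ℝ ∙ n)ᗮ.orthogonalProjectionOnto (y - z)‖ := rfl
  rw [e4] at e3
  push_cast
  linarith

theorem IsSmoothBoundedDomain.isFiniteMeasure_surf (hΩ : IsSmoothBoundedDomain Ω) :
    IsFiniteMeasure (surf Ω) := by
  refine ⟨?_⟩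
  rw [Measure.restrict_apply_univ]
  exact (hΩ.isBounded.isCompact_closure.of_isClosed_subset isClosed_frontier
    frontier_subset_closure).measure_lt_top_of_nhdsWithin fun x hx =>
      finiteAtFilter_frontier hΩ hx

theorem IsSmoothBoundedDomain.isFiniteMeasure_bulk (hΩ : IsSmoothBoundedDomain Ω) :
    IsFiniteMeasure (bulk Ω) :=
  ⟨by rw [Measure.restrict_apply_univ]; exact hΩ.isBounded.measure_lt_top⟩

theorem IsSmoothBoundedDomain.measure_pos (hΩ : IsSmoothBoundedDomain Ω)
    [IsFiniteMeasure (bulk Ω)] : 0 < (bulk Ω).real univ := by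
  rw [measureReal_def, Measure.restrict_apply_univ]
  refine ENNReal.toReal_pos ?_ hΩ.isBounded.measure_lt_top.ne
  exact (hΩ.isOpen.measure_pos volume hΩ.isConnected.nonempty).ne'

/-! ### Gradients and constants in the product spaces -/

/-- The map `((a, b), (a', b')) ↦ (b, b')`. -/
def secondParts (A B A' B' : Type*) [NormedAddCommGroup A] [NormedSpace ℝ A]
    [NormedAddCommGroup B] [NormedSpace ℝ B] [NormedAddCommGroup A'] [NormedSpace ℝ A']
    [NormedAddCommGroup B'] [NormedSpace ℝ B'] :
    WithLp 2 (WithLp 2 (A × B) × WithLp 2 (A' × B')) →L[ℝ] WithLp 2 (B × B') where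
  toFun z := WithLp.toLp 2 (z.fst.snd, z.snd.snd)
  map_add' _ _ := rfl
  map_smul' _ _ := rfl
  cont := by fun_prop

/-- The Hilbert space `L²(Ω; ℝ^d) × L²(Γ; ℝ^d)` in which the gradients of elements of `𝐕` live. -/
abbrev GradSpace {d : ℕ} (Ω : Set (E d)) : Type :=
  WithLp 2 (Lp (E d) 2 (bulk Ω) × Lp (E d) 2 (surf Ω))

/-- The pair of gradients `(∇z, ∇_Γ z_Γ)`. -/
noncomputable def toGrad {d : ℕ} (Ω : Set (E d)) : Jets Ω →L[ℝ] GradSpace Ω :=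
  secondParts (Lp ℝ 2 (bulk Ω)) (Lp (E d) 2 (bulk Ω)) (Lp ℝ 2 (surf Ω)) (Lp (E d) 2 (surf Ω))

theorem inner_secondParts {A B A' B' : Type*} [NormedAddCommGroup A] [NormedSpace ℝ A]
    [NormedAddCommGroup B] [InnerProductSpace ℝ B] [NormedAddCommGroup A'] [NormedSpace ℝ A']
    [NormedAddCommGroup B'] [InnerProductSpace ℝ B']
    (u z : WithLp 2 (WithLp 2 (A × B) × WithLp 2 (A' × B'))) :
    inner ℝ (secondParts A B A' B' u) (secondParts A B A' B' z)
      = inner ℝ u.fst.snd z.fst.snd + inner ℝ u.snd.snd z.snd.snd :=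
  rfl

theorem aForm_eq_inner (u z : Jets Ω) : aForm u z = inner ℝ (toGrad Ω u) (toGrad Ω z) := by
  refine Eq.trans ?_ (inner_secondParts u z).symm
  rw [L2.inner_def, L2.inner_def, aForm]

theorem normV0_eq_norm (z : BoldV0 Ω) : normV0 z = ‖toGrad Ω z‖ := by
  rw [normV0, aForm_eq_inner, real_inner_self_eq_norm_sq, Real.sqrt_sq (norm_nonneg _)]

theorem toV0Dual_apply (v z : BoldV0 Ω) : toV0Dual v z = inner ℝ (toH Ω v) (toH Ω z) := rfl

theorem hToVDual_apply (g : BoldH Ω) (z : BoldV Ω) :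
    hToVDual g z = inner ℝ g (toH Ω z) := rfl

theorem toV0Dual_sub_apply (v w z : BoldV0 Ω) :
    toV0Dual (v - w) z = toV0Dual v z - toV0Dual w z := by
  rw [toV0Dual_apply, toV0Dual_apply, toV0Dual_apply, Submodule.coe_sub, map_sub, inner_sub_left]

/-- The constant function `𝟏 = (1, 1)`, with zero gradients. -/
noncomputable def oneJets {d : ℕ} (Ω : Set (E d)) [IsFiniteMeasure (bulk Ω)]
    [IsFiniteMeasure (surf Ω)] : Jets Ω :=
  WithLp.toLp 2 (WithLp.toLp 2 (Lp.const 2 (bulk Ω) (1 : ℝ), 0),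
    WithLp.toLp 2 (Lp.const 2 (surf Ω) (1 : ℝ), 0))

/-- The integral over `Ω` of a partial derivative of a test function vanishes. -/
theorem setIntegral_fderiv_eq_zero {φ : E d → ℝ} (h1 : ContDiff ℝ ∞ φ) (h2 : HasCompactSupport φ)
    (h3 : tsupport φ ⊆ Ω) (e : E d) : ∫ x in Ω, fderiv ℝ φ x e = 0 := by
  have hi : Integrable (fun x => fderiv ℝ φ x e) (volume : Measure (E d)) :=
    ((h1.continuous_fderiv (by simp)).clm_apply continuous_const).integrable_of_hasCompactSupport
      (h2.fderiv_apply (𝕜 := ℝ) e)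
  have hsupp : Function.support (fun x => fderiv ℝ φ x e) ⊆ Ω :=
    ((subset_tsupport _).trans (tsupport_fderiv_apply_subset ℝ e)).trans h3
  rw [setIntegral_eq_integral_of_forall_compl_eq_zero fun x hx =>
    Function.notMem_support.mp fun h => hx (hsupp h)]
  have h := integral_mul_fderiv_eq_neg_fderiv_mul_of_integrable (μ := (volume : Measure (E d)))
    (f := fun _ : E d => (1 : ℝ)) (g := φ) (v := e) (by simp)
    (by simpa using hi) (by simpa using h1.continuous.integrable_of_hasCompactSupport h2)
    (fun _ _ => differentiableAt_const _) (fun x _ => h1.differentiable (by simp) x)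
  simpa using h

section FiniteMeasure

variable [IsFiniteMeasure (bulk Ω)] [IsFiniteMeasure (surf Ω)]

theorem toGrad_oneJets : toGrad Ω (oneJets Ω) = 0 := rfl

theorem oneJets_mem_BoldV : oneJets Ω ∈ BoldV Ω := by
  have b1 : (oneJets Ω).fst.fst =ᵐ[bulk Ω] fun _ => (1 : ℝ) := Lp.coeFn_const ..
  have b2 : (oneJets Ω).fst.snd =ᵐ[bulk Ω] fun _ => (0 : E d) := Lp.coeFn_zero ..
  have s1 : (oneJets Ω).snd.fst =ᵐ[surf Ω] fun _ => (1 : ℝ) := Lp.coeFn_const ..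
  have s2 : (oneJets Ω).snd.snd =ᵐ[surf Ω] fun _ => (0 : E d) := Lp.coeFn_zero ..
  refine ⟨?_, ?_, ?_⟩
  · intro φ h1 h2 h3 e
    have e1 : ∀ᵐ x ∂(bulk Ω), (oneJets Ω).fst.fst x * fderiv ℝ φ x e = fderiv ℝ φ x e := by
      filter_upwards [b1] with x hx
      rw [hx, one_mul]
    have e2 : ∀ᵐ x ∂(bulk Ω), inner ℝ ((oneJets Ω).fst.snd x) e * φ x = 0 := by
      filter_upwards [b2] with x hx
      rw [hx, inner_zero_left, zero_mul]
    rw [integral_congr_ae e1, integral_eq_zero_of_ae e2, neg_zero]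
    exact setIntegral_fderiv_eq_zero h1 h2 h3 e
  · refine Submodule.le_topologicalClosure _ ⟨fun _ => 1, contDiff_const, s1, ?_⟩
    filter_upwards [s2] with x hx
    rw [hx]
    simp [surfGrad, gradient]
  · refine subset_closure ⟨fun _ => 1, contDiff_const, b1, ?_, s1⟩
    filter_upwards [b2] with x hx
    rw [hx]
    simp [gradient]

theorem inner_toH_oneJets (z : BoldH Ω) :
    inner ℝ z (toH Ω (oneJets Ω)) = (∫ x, z.fst x ∂(bulk Ω)) + ∫ x, z.snd x ∂(surf Ω) := by
  have b1 : (oneJets Ω).fst.fst =ᵐ[bulk Ω] fun _ => (1 : ℝ) := Lp.coeFn_const ..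
  have s1 : (oneJets Ω).snd.fst =ᵐ[surf Ω] fun _ => (1 : ℝ) := Lp.coeFn_const ..
  rw [WithLp.prod_inner_apply, L2.inner_def, L2.inner_def]
  congr 1 <;> refine integral_congr_ae ?_
  · filter_upwards [b1] with x hx
    change inner ℝ (z.fst x) ((oneJets Ω).fst.fst x) = _
    rw [hx]; simp
  · filter_upwards [s1] with x hx
    change inner ℝ (z.snd x) ((oneJets Ω).snd.fst x) = _
    rw [hx]; simp

/-- Elements of `𝐕₀` are orthogonal to constants in `𝐇`. -/
theorem inner_toH_oneJets_eq_zero (hpos : 0 < (bulk Ω).real univ) (z : BoldV0 Ω) :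
    inner ℝ (toH Ω z) (toH Ω (oneJets Ω)) = 0 := by
  have h := z.2.2.2.2
  rw [mean, div_eq_zero_iff] at h
  rw [inner_toH_oneJets]
  exact h.resolve_right (add_pos_of_pos_of_nonneg hpos measureReal_nonneg).ne'

/-- Subtracting its mean value from an element of `𝐕` gives an element of `𝐕₀`. -/
theorem exists_sub_smul_oneJets_mem (hpos : 0 < (bulk Ω).real univ) {z : Jets Ω}
    (hz : z ∈ BoldV Ω) : ∃ c : ℝ, z - c • oneJets Ω ∈ BoldV0 Ω := by
  have hpos' : 0 < (bulk Ω).real univ + (surf Ω).real univ :=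
    add_pos_of_pos_of_nonneg hpos measureReal_nonneg
  refine ⟨mean (toH Ω z), sub_mem hz (Submodule.smul_mem _ _ oneJets_mem_BoldV), ?_, ?_, ?_⟩
  · exact (Lp.memLp _).integrable (by norm_num)
  · exact (Lp.memLp _).integrable (by norm_num)
  · have b1 : (oneJets Ω).fst.fst =ᵐ[bulk Ω] fun _ => (1 : ℝ) := Lp.coeFn_const ..
    have s1 : (oneJets Ω).snd.fst =ᵐ[surf Ω] fun _ => (1 : ℝ) := Lp.coeFn_const ..
    have h1 : inner ℝ (toH Ω (oneJets Ω)) (toH Ω (oneJets Ω))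
        = (bulk Ω).real univ + (surf Ω).real univ := by
      rw [inner_toH_oneJets, toH_fst, toH_snd, integral_congr_ae b1, integral_congr_ae s1]
      simp
    rw [mean, ← inner_toH_oneJets, map_sub, map_smul, inner_sub_left, real_inner_smul_left, h1,
      inner_toH_oneJets, mean, div_mul_cancel₀ _ hpos'.ne', sub_self, zero_div]

end FiniteMeasure

/-! ### Monotone and Lipschitz nonlinearities -/

/-- A subdifferential is a monotone graph. -/
theorem subdiff_monotone {b : ℝ → ℝ≥0∞} {r s y z : ℝ} (hy : y ∈ subdiff b r)
    (hz : z ∈ subdiff b s) : 0 ≤ (y - z) * (r - s) := by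
  have h1 := hy.2 s hz.1
  have h2 := hz.2 r hy.1
  linarith

theorem memLp_lipschitz_comp {X : Type*} [MeasurableSpace X] {m : Measure X} [IsFiniteMeasure m]
    {π : ℝ → ℝ} {L : ℝ≥0} (hπ : LipschitzWith L π) (m₀ : ℝ) (u : Lp ℝ 2 m) :
    MemLp (fun x => π (u x + m₀)) 2 m := by
  have h : MemLp (fun x => ‖u x‖ * L + ‖π m₀‖) 2 m :=
    ((Lp.memLp u).norm.mul_const _).add (memLp_const _)
  refine h.mono (hπ.continuous.comp_aestronglyMeasurable
    ((Lp.aestronglyMeasurable u).add_const m₀)) (Filter.Eventually.of_forall fun x => ?_)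
  have h1 := hπ.dist_le_mul (u x + m₀) m₀
  rw [dist_eq_norm, dist_eq_norm, add_sub_cancel_right] at h1
  have h2 := norm_le_norm_add_norm_sub' (π (u x + m₀)) (π m₀)
  refine le_trans ?_ (Real.le_norm_self _)
  linarith

/-- The contribution of one of the two components to the dissipation: the monotone part has a sign,
the Lipschitz part is bounded by the `L²` norm. -/
theorem neg_le_integral_sub_integral {X : Type*} [MeasurableSpace X] {m : Measure X}
    [IsFiniteMeasure m] {b : ℝ → ℝ≥0∞} {π : ℝ → ℝ} {L : ℝ≥0} (hπ : LipschitzWith L π) {m₀ : ℝ}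
    {u₁ u₂ ξ₁ ξ₂ f₁ f₂ : Lp ℝ 2 m} (h₁ : ∀ᵐ x ∂m, ξ₁ x ∈ subdiff b (u₁ x + m₀))
    (h₂ : ∀ᵐ x ∂m, ξ₂ x ∈ subdiff b (u₂ x + m₀)) :
    -(L * inner ℝ (u₁ - u₂) (u₁ - u₂)) - inner ℝ (f₁ - f₂) (u₁ - u₂)
      ≤ (∫ x, (ξ₁ x + π (u₁ x + m₀) - f₁ x) * (u₁ - u₂ : Lp ℝ 2 m) x ∂m)
        - ∫ x, (ξ₂ x + π (u₂ x + m₀) - f₂ x) * (u₁ - u₂ : Lp ℝ 2 m) x ∂m := by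
  have i : ∀ u ξ f : Lp ℝ 2 m,
      Integrable (fun x => (ξ x + π (u x + m₀) - f x) * (u₁ - u₂ : Lp ℝ 2 m) x) m := fun u ξ f =>
    (((Lp.memLp ξ).add (memLp_lipschitz_comp hπ m₀ u)).sub (Lp.memLp f)).integrable_mul
      (Lp.memLp (u₁ - u₂))
  have j1 : Integrable (fun x => inner ℝ ((u₁ - u₂ : Lp ℝ 2 m) x) ((u₁ - u₂ : Lp ℝ 2 m) x)) m :=
    L2.integrable_inner _ _
  have j2 : Integrable (fun x => inner ℝ ((f₁ - f₂ : Lp ℝ 2 m) x) ((u₁ - u₂ : Lp ℝ 2 m) x)) m :=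
    L2.integrable_inner _ _
  have j3 : Integrable (fun x => -((L : ℝ) *
      inner ℝ ((u₁ - u₂ : Lp ℝ 2 m) x) ((u₁ - u₂ : Lp ℝ 2 m) x))) m := (j1.const_mul _).neg
  rw [L2.inner_def, L2.inner_def, ← integral_sub (i _ _ _) (i _ _ _), ← integral_const_mul,
    ← integral_neg, ← integral_sub j3 j2]
  refine integral_mono_ae (j3.sub j2) ((i _ _ _).sub (i _ _ _)) ?_
  filter_upwards [h₁, h₂, Lp.coeFn_sub u₁ u₂, Lp.coeFn_sub f₁ f₂] with x k1 k2 e1 e2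
  rw [e1, e2, Pi.sub_apply, Pi.sub_apply]
  simp only [RCLike.inner_apply, conj_trivial]
  have hm := subdiff_monotone k1 k2
  have hl := hπ.dist_le_mul (u₁ x + m₀) (u₂ x + m₀)
  rw [Real.dist_eq, Real.dist_eq, add_sub_add_right_eq_sub] at hl
  rw [add_sub_add_right_eq_sub] at hm
  have hl2 : -(L * ((u₁ x - u₂ x) * (u₁ x - u₂ x)))
      ≤ (π (u₁ x + m₀) - π (u₂ x + m₀)) * (u₁ x - u₂ x) := by
    refine (neg_le_neg ?_).trans (neg_abs_le _)
    rw [abs_mul, ← abs_mul_abs_self (u₁ x - u₂ x), ← mul_assoc]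
    exact mul_le_mul_of_nonneg_right hl (abs_nonneg _)
  linarith

/-! ### The two equations in an abstract Hilbert space setting -/

variable {T : ℝ}

section Abstract

theorem ae_of_ae_restrict_Ioo {P : ℝ → Prop} (h : ∀ᵐ s ∂(volume.restrict (Ioo 0 T)), P s) {t : ℝ}
    (ht : t ≤ T) : ∀ᵐ s ∂(volume.restrict (Ioc 0 t)), P s := by
  rw [restrict_Ioo_eq_restrict_Ioc] at h
  exact ae_mono (Measure.restrict_mono (Ioc_subset_Ioc_right ht) le_rfl) h

theorem intervalIntegrable_of_memLp {F : Type*} [NormedAddCommGroup F] {p : ℝ≥0∞} (hp : 1 ≤ p)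
    {w : ℝ → F} (hw : MemLp w p (volume.restrict (Ioo 0 T))) {t : ℝ} (ht : t ∈ Icc 0 T) :
    IntervalIntegrable w volume 0 t := by
  rw [intervalIntegrable_iff_integrableOn_Ioc_of_le ht.1]
  rw [restrict_Ioo_eq_restrict_Ioc] at hw
  have h : IntegrableOn w (Ioc 0 T) volume := hw.integrable hp
  exact h.mono_set (Ioc_subset_Ioc_right ht.2)

variable {G : Type*} [NormedAddCommGroup G] [InnerProductSpace ℝ G] [CompleteSpace G]

/-- If `l' = -⟪w, A ·⟫` in the dual of `X`, then `l(t) = l(0) - ⟪∫ w, A ·⟫`. -/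
theorem apply_eq_sub_inner_integral {X : Type*} [NormedAddCommGroup X] [NormedSpace ℝ X]
    {A : X → G} {l : ℝ → StrongDual ℝ X} {l' : ℝ → StrongDual ℝ X} {w : ℝ → G}
    (hw : MemLp w 2 (volume.restrict (Ioo 0 T))) (hl' : MemLp l' 2 (volume.restrict (Ioo 0 T)))
    (hl : ∀ t ∈ Icc 0 T, l t = l 0 + ∫ s in (0 : ℝ)..t, l' s)
    (h : ∀ᵐ s ∂(volume.restrict (Ioo 0 T)), ∀ z, l' s z + inner ℝ (w s) (A z) = 0)
    {t : ℝ} (ht : t ∈ Icc 0 T) (z : X) :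
    l t z = l 0 z - inner ℝ (∫ s in (0 : ℝ)..t, w s) (A z) := by
  have hl'i : IntervalIntegrable l' volume 0 t := intervalIntegrable_of_memLp (by norm_num) hl' ht
  have hwi : IntervalIntegrable w volume 0 t := intervalIntegrable_of_memLp (by norm_num) hw ht
  have h1 : (∫ s in (0 : ℝ)..t, l' s) z = ∫ s in (0 : ℝ)..t, l' s z :=
    ContinuousLinearMap.intervalIntegral_apply hl'i z
  have h2 : (∫ s in (0 : ℝ)..t, l' s z) = ∫ s in (0 : ℝ)..t, -(innerSL ℝ (A z) (w s)) := by
    rw [intervalIntegral.integral_of_le ht.1, intervalIntegral.integral_of_le ht.1]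
    refine integral_congr_ae ?_
    filter_upwards [ae_of_ae_restrict_Ioo h ht.2] with s hs
    rw [innerSL_apply_apply, real_inner_comm]
    linarith [hs z]
  rw [hl t ht, _root_.add_apply, h1, h2, intervalIntegral.integral_neg,
    (innerSL ℝ (A z)).intervalIntegral_comp_comm hwi, innerSL_apply_apply, real_inner_comm,
    sub_eq_add_neg]

/-- The energy estimate. In the application `x` is the difference of two solutions, `y` and `w`
are the difference of the chemical potentials and its gradient, and `g(s) = g₀ - ∫₀ˢ w` is the
gradient of the solution of the stationary problem with right-hand side `x(s)`. The hypothesis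
`hwg` says that this problem may be tested with `y(s)`. -/
theorem exists_norm_sq_add_integral_le {X H : Type*} [NormedAddCommGroup H]
    [InnerProductSpace ℝ H] {A : X → G} {J : X → H} {x : ℝ → X} {y φ : ℝ → H} {w : ℝ → G} {g₀ : G}
    {q : ℝ → ℝ} {K : ℝ} (hK : 0 ≤ K)
    (hw : MemLp w 2 (volume.restrict (Ioo 0 T)))
    (hx : MemLp (fun s => A (x s)) ⊤ (volume.restrict (Ioo 0 T)))
    (hrep : ∀ s ∈ Icc 0 T, ∀ z,
      inner ℝ (J (x s)) (J z) = inner ℝ (g₀ - ∫ r in (0 : ℝ)..s, w r) (A z))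
    (hwg : ∀ s g, (∀ z, inner ℝ (J (x s)) (J z) = inner ℝ g (A z)) →
      inner ℝ (w s) g = inner ℝ (y s) (J (x s)))
    (hdiss : ∀ᵐ s ∂(volume.restrict (Ioo 0 T)), ‖A (x s)‖ ^ 2
      ≤ inner ℝ (y s) (J (x s)) + K * ‖J (x s)‖ ^ 2 + inner ℝ (φ s) (J (x s)))
    {t : ℝ} (ht : t ∈ Icc 0 T) (hq : IntervalIntegrable q volume 0 t) (hq0 : ∀ s, 0 ≤ q s)
    (hφ : ∀ᵐ s ∂(volume.restrict (Ioo 0 T)),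
      2 * inner ℝ (φ s) (J (x s)) ≤ 1 / 2 * ‖A (x s)‖ ^ 2 + q s) :
    IntervalIntegrable (fun s => ‖A (x s)‖ ^ 2) volume 0 t ∧
    ∃ g : G, (∀ z, inner ℝ (J (x t)) (J z) = inner ℝ g (A z)) ∧
      ‖g‖ ^ 2 + ∫ s in (0 : ℝ)..t, ‖A (x s)‖ ^ 2
        ≤ Real.exp (2 * K ^ 2 * t) * (‖g₀‖ ^ 2 + ∫ s in (0 : ℝ)..t, q s) := by
  have hwi : IntervalIntegrable w volume 0 t := intervalIntegrable_of_memLp (by norm_num) hw ht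
  have hpi : IntervalIntegrable (fun s => ‖A (x s)‖ ^ 2) volume 0 t :=
    intervalIntegrable_of_memLp le_rfl (memLp_one_iff_integrable.mpr
      ((hx.mono_exponent (p := 2) le_top).integrable_norm_pow (by norm_num))) ht
  refine ⟨hpi, g₀ - ∫ r in (0 : ℝ)..t, w r, hrep t ht, ?_⟩
  refine norm_sq_add_integral_le_exp_mul ht.1 (by positivity) hwi hpi hq
    (fun s => by positivity) hq0 ?_
  filter_upwards [(ae_restrict_iff' measurableSet_Ioo).mp hφ,
    (ae_restrict_iff' measurableSet_Ioo).mp hdiss] with s k1 k2 hs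
  have hsT : s ∈ Ioo 0 T := ⟨hs.1, hs.2.trans_le ht.2⟩
  have hr := hrep s ⟨hsT.1.le, hsT.2.le⟩
  replace k1 := k1 hsT
  replace k2 := k2 hsT
  set g : G := g₀ - ∫ r in (0 : ℝ)..s, w r with hg
  rw [← hwg s g hr] at k2
  -- `|𝐯|²_𝐇 = ⟪g, ∇𝐯⟫`, which avoids any Poincaré inequality in this term
  have hzz : ‖J (x s)‖ ^ 2 ≤ ‖g‖ * ‖A (x s)‖ := by
    rw [← real_inner_self_eq_norm_sq, hr]
    exact real_inner_le_norm _ _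
  have hKz := mul_le_mul_of_nonneg_left hzz hK
  linarith [sq_nonneg (2 * K * ‖g‖ - ‖A (x s)‖)]

end Abstract

/-! ### The difference of two weak solutions -/

theorem sub_fst_fst {A B A' B' : Type*} [NormedAddCommGroup A] [NormedAddCommGroup B]
    [NormedAddCommGroup A'] [NormedAddCommGroup B']
    (u z : WithLp 2 (WithLp 2 (A × B) × WithLp 2 (A' × B'))) :
    (u - z).fst.fst = u.fst.fst - z.fst.fst :=
  rfl

theorem sub_snd_fst {A B A' B' : Type*} [NormedAddCommGroup A] [NormedAddCommGroup B]
    [NormedAddCommGroup A'] [NormedAddCommGroup B']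
    (u z : WithLp 2 (WithLp 2 (A × B) × WithLp 2 (A' × B'))) :
    (u - z).snd.fst = u.snd.fst - z.snd.fst :=
  rfl

section Products

variable {A B A' B' : Type*} [NormedAddCommGroup A] [InnerProductSpace ℝ A]
  [NormedAddCommGroup B] [NormedSpace ℝ B] [NormedAddCommGroup A'] [InnerProductSpace ℝ A']
  [NormedAddCommGroup B'] [NormedSpace ℝ B']

theorem inner_firstParts_self (z : WithLp 2 (WithLp 2 (A × B) × WithLp 2 (A' × B'))) :
    inner ℝ (firstParts A B A' B' z) (firstParts A B A' B' z)
      = inner ℝ z.fst.fst z.fst.fst + inner ℝ z.snd.fst z.snd.fst :=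
  rfl

theorem inner_sub_firstParts (f g : WithLp 2 (A × A'))
    (z : WithLp 2 (WithLp 2 (A × B) × WithLp 2 (A' × B'))) :
    inner ℝ (f - g) (firstParts A B A' B' z)
      = inner ℝ (f.fst - g.fst) z.fst.fst + inner ℝ (f.snd - g.snd) z.snd.fst :=
  rfl

end Products

section WeakSolution

variable {β βΓ : ℝ → Set ℝ} {π πΓ : ℝ → ℝ} {f : ℝ → BoldH Ω} {m₀ : ℝ} {v₀ : BoldV0 Ω}
  {v : ℝ → BoldV0 Ω} {μ : ℝ → BoldV Ω} {ξ : ℝ → BoldH Ω}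

theorem IsWeakSolution.memLp_toGrad_μ (h : IsWeakSolution Ω T β βΓ π πΓ f m₀ v₀ v μ ξ) :
    MemLp (fun s => toGrad Ω (μ s)) 2 (volume.restrict (Ioo 0 T)) :=
  ((toGrad Ω).comp (BoldV Ω).subtypeL).comp_memLp' h.μ_memLp

theorem IsWeakSolution.memLp_toGrad_v (h : IsWeakSolution Ω T β βΓ π πΓ f m₀ v₀ v μ ξ) :
    MemLp (fun s => toGrad Ω (v s)) ⊤ (volume.restrict (Ioo 0 T)) :=
  ((toGrad Ω).comp (BoldV0 Ω).subtypeL).comp_memLp' h.v_memLp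

/-- The first equation, integrated in time: `𝐯(t)` acts on `𝐕₀` as `𝐯₀` minus the gradient of the
primitive of `𝛍`. -/
theorem IsWeakSolution.toV0Dual_apply_eq (h : IsWeakSolution Ω T β βΓ π πΓ f m₀ v₀ v μ ξ)
    {t : ℝ} (ht : t ∈ Icc 0 T) (z : BoldV0 Ω) :
    toV0Dual (v t) z
      = toV0Dual v₀ z - inner ℝ (∫ s in (0 : ℝ)..t, toGrad Ω (μ s)) (toGrad Ω z) := by
  obtain ⟨v', hv', hv, he⟩ := h.eq_one
  have he' : ∀ᵐ s ∂(volume.restrict (Ioo 0 T)), ∀ z : BoldV0 Ω,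
      v' s z + inner ℝ (toGrad Ω (μ s)) (toGrad Ω z) = 0 := by
    filter_upwards [he] with s hs z
    rw [← aForm_eq_inner]
    exact hs z
  have h0 : toV0Dual (v 0) z = toV0Dual v₀ z := by
    rw [toV0Dual_apply, toV0Dual_apply, h.init]
  rw [← h0]
  exact apply_eq_sub_inner_integral (A := fun z : BoldV0 Ω => toGrad Ω z)
    (l := fun t => toV0Dual (v t)) h.memLp_toGrad_μ hv' hv he' ht z

end WeakSolution

section TwoSolutions

variable {b bΓ : ℝ → ℝ≥0∞} {π πΓ : ℝ → ℝ} {L LΓ : ℝ≥0} {m₀ : ℝ} {f₁ f₂ : ℝ → BoldH Ω}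
  {v₀₁ v₀₂ : BoldV0 Ω} {v₁ v₂ : ℝ → BoldV0 Ω} {μ₁ μ₂ : ℝ → BoldV Ω} {ξ₁ ξ₂ : ℝ → BoldH Ω}

/-- The second equations for two solutions, subtracted and tested with the difference of the
solutions. -/
theorem IsWeakSolution.ae_norm_toGrad_sq_le [IsFiniteMeasure (bulk Ω)] [IsFiniteMeasure (surf Ω)]
    (hπ : LipschitzWith L π) (hπΓ : LipschitzWith LΓ πΓ)
    (h₁ : IsWeakSolution Ω T (subdiff b) (subdiff bΓ) π πΓ f₁ m₀ v₀₁ v₁ μ₁ ξ₁)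
    (h₂ : IsWeakSolution Ω T (subdiff b) (subdiff bΓ) π πΓ f₂ m₀ v₀₂ v₂ μ₂ ξ₂) :
    ∀ᵐ s ∂(volume.restrict (Ioo 0 T)),
      ‖toGrad Ω (v₁ s - v₂ s : BoldV0 Ω)‖ ^ 2
        ≤ inner ℝ (toH Ω (μ₁ s - μ₂ s : BoldV Ω)) (toH Ω (v₁ s - v₂ s : BoldV0 Ω))
          + max (L : ℝ) LΓ * ‖toH Ω (v₁ s - v₂ s : BoldV0 Ω)‖ ^ 2
          + inner ℝ (f₁ s - f₂ s) (toH Ω (v₁ s - v₂ s : BoldV0 Ω)) := by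
  filter_upwards [h₁.eq_two, h₂.eq_two, h₁.ξ_bulk, h₂.ξ_bulk, h₁.ξ_surf, h₂.ξ_surf]
    with s e₁ e₂ b₁ b₂ s₁ s₂
  set z : BoldV0 Ω := v₁ s - v₂ s with hz
  have hzV : (z : Jets Ω) ∈ BoldV Ω := z.2.1
  have k₁ := e₁ ⟨z, hzV⟩
  have k₂ := e₂ ⟨z, hzV⟩
  dsimp only at k₁ k₂
  have hzc : (z : Jets Ω) = (v₁ s : Jets Ω) - (v₂ s : Jets Ω) := rfl
  have n1 := neg_le_integral_sub_integral hπ (f₁ := (f₁ s).fst) (f₂ := (f₂ s).fst) b₁ b₂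
  have n2 := neg_le_integral_sub_integral hπΓ (f₁ := (f₁ s).snd) (f₂ := (f₂ s).snd) s₁ s₂
  have d1 : (v₁ s : Jets Ω).fst.fst - (v₂ s : Jets Ω).fst.fst = (z : Jets Ω).fst.fst :=
    (sub_fst_fst (v₁ s : Jets Ω) (v₂ s : Jets Ω)).symm
  have d2 : (v₁ s : Jets Ω).snd.fst - (v₂ s : Jets Ω).snd.fst = (z : Jets Ω).snd.fst :=
    (sub_snd_fst (v₁ s : Jets Ω) (v₂ s : Jets Ω)).symm
  rw [d1] at n1
  rw [d2] at n2
  have g1 : ‖toGrad Ω z‖ ^ 2 = aForm (v₁ s : Jets Ω) z - aForm (v₂ s : Jets Ω) z := by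
    rw [aForm_eq_inner, aForm_eq_inner, ← inner_sub_left, ← map_sub, ← hzc,
      real_inner_self_eq_norm_sq]
  have g2 : inner ℝ (toH Ω (μ₁ s - μ₂ s : BoldV Ω)) (toH Ω z)
      = inner ℝ (toH Ω (μ₁ s)) (toH Ω z) - inner ℝ (toH Ω (μ₂ s)) (toH Ω z) := by
    rw [Submodule.coe_sub, map_sub, inner_sub_left]
  have g3 : ‖toH Ω z‖ ^ 2 = inner ℝ (z : Jets Ω).fst.fst (z : Jets Ω).fst.fst
      + inner ℝ (z : Jets Ω).snd.fst (z : Jets Ω).snd.fst := by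
    rw [← real_inner_self_eq_norm_sq]
    exact inner_firstParts_self (z : Jets Ω)
  have g4 : inner ℝ (f₁ s - f₂ s) (toH Ω z)
      = inner ℝ ((f₁ s).fst - (f₂ s).fst) (z : Jets Ω).fst.fst
        + inner ℝ ((f₁ s).snd - (f₂ s).snd) (z : Jets Ω).snd.fst := by
    exact inner_sub_firstParts (f₁ s) (f₂ s) (z : Jets Ω)
  have g5 : (L : ℝ) * inner ℝ (z : Jets Ω).fst.fst (z : Jets Ω).fst.fst
      ≤ max (L : ℝ) LΓ * inner ℝ (z : Jets Ω).fst.fst (z : Jets Ω).fst.fst :=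
    mul_le_mul_of_nonneg_right (le_max_left _ _) real_inner_self_nonneg
  have g6 : (LΓ : ℝ) * inner ℝ (z : Jets Ω).snd.fst (z : Jets Ω).snd.fst
      ≤ max (L : ℝ) LΓ * inner ℝ (z : Jets Ω).snd.fst (z : Jets Ω).snd.fst :=
    mul_le_mul_of_nonneg_right (le_max_right _ _) real_inner_self_nonneg
  rw [g1, g2, g3, g4, k₁, k₂, mul_add]
  linarith

/-- The stationary problem, posed for test functions of mean value zero, may be tested with any
element `y` of `𝐕`, because the mean value of `y` is invisible on both sides. -/
theorem inner_toGrad_eq_of_forall (hpos : 0 < (bulk Ω).real univ) [IsFiniteMeasure (bulk Ω)]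
    [IsFiniteMeasure (surf Ω)] {x : BoldV0 Ω} {g : GradSpace Ω}
    (h : ∀ z : BoldV0 Ω, inner ℝ (toH Ω x) (toH Ω z) = inner ℝ g (toGrad Ω z)) (y : BoldV Ω) :
    inner ℝ (toGrad Ω y) g = inner ℝ (toH Ω y) (toH Ω x) := by
  obtain ⟨c, hc⟩ := exists_sub_smul_oneJets_mem hpos y.2
  have h3 := h ⟨_, hc⟩
  rw [map_sub, map_sub, map_smul, map_smul, toGrad_oneJets, smul_zero, sub_zero, inner_sub_right,
    real_inner_smul_right, inner_toH_oneJets_eq_zero hpos x, mul_zero, sub_zero] at h3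
  rw [real_inner_comm, ← h3, real_inner_comm]

/-- The energy estimate for the difference of two weak solutions. The vector `g₀` represents the
difference of the initial values, and `g` that of the solutions at time `t`. -/
theorem IsWeakSolution.energy_estimate (hΩ : IsSmoothBoundedDomain Ω)
    (hπ : LipschitzWith L π) (hπΓ : LipschitzWith LΓ πΓ)
    (h₁ : IsWeakSolution Ω T (subdiff b) (subdiff bΓ) π πΓ f₁ m₀ v₀₁ v₁ μ₁ ξ₁)
    (h₂ : IsWeakSolution Ω T (subdiff b) (subdiff bΓ) π πΓ f₂ m₀ v₀₂ v₂ μ₂ ξ₂)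
    {g₀ : GradSpace Ω} (hg₀ : ∀ z : BoldV0 Ω, toV0Dual (v₀₁ - v₀₂) z = inner ℝ g₀ (toGrad Ω z))
    {t : ℝ} (ht : t ∈ Icc 0 T) {q : ℝ → ℝ} (hq : IntervalIntegrable q volume 0 t)
    (hq0 : ∀ s, 0 ≤ q s)
    (hfq : ∀ᵐ s ∂(volume.restrict (Ioo 0 T)),
      2 * inner ℝ (f₁ s - f₂ s) (toH Ω (v₁ s - v₂ s : BoldV0 Ω))
        ≤ 1 / 2 * ‖toGrad Ω (v₁ s - v₂ s : BoldV0 Ω)‖ ^ 2 + q s) :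
    IntervalIntegrable (fun s => ‖toGrad Ω (v₁ s - v₂ s : BoldV0 Ω)‖ ^ 2) volume 0 t ∧
    ∃ g : GradSpace Ω, (∀ z : BoldV0 Ω, toV0Dual (v₁ t - v₂ t) z = inner ℝ g (toGrad Ω z)) ∧
      ‖g‖ ^ 2 + ∫ s in (0 : ℝ)..t, ‖toGrad Ω (v₁ s - v₂ s : BoldV0 Ω)‖ ^ 2
        ≤ Real.exp (2 * max (L : ℝ) LΓ ^ 2 * t) * (‖g₀‖ ^ 2 + ∫ s in (0 : ℝ)..t, q s) := by
  have := hΩ.isFiniteMeasure_bulk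
  have := hΩ.isFiniteMeasure_surf
  have hμ : ∀ s, toGrad Ω (μ₁ s - μ₂ s : BoldV Ω) = toGrad Ω (μ₁ s) - toGrad Ω (μ₂ s) := fun s => by
    rw [Submodule.coe_sub, map_sub]
  have hv : ∀ s, toGrad Ω (v₁ s - v₂ s : BoldV0 Ω) = toGrad Ω (v₁ s) - toGrad Ω (v₂ s) :=
    fun s => by rw [Submodule.coe_sub, map_sub]
  refine exists_norm_sq_add_integral_le (A := fun z : BoldV0 Ω => toGrad Ω z)
    (J := fun z : BoldV0 Ω => toH Ω z) (x := fun s => v₁ s - v₂ s)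
    (y := fun s => toH Ω (μ₁ s - μ₂ s : BoldV Ω)) (φ := fun s => f₁ s - f₂ s)
    (w := fun s => toGrad Ω (μ₁ s - μ₂ s : BoldV Ω)) (le_max_of_le_left L.2) ?_ ?_ ?_
    (fun s g h => inner_toGrad_eq_of_forall hΩ.measure_pos h _)
    (h₁.ae_norm_toGrad_sq_le hπ hπΓ h₂) ht hq hq0 hfq
  · simp only [hμ]
    exact h₁.memLp_toGrad_μ.sub h₂.memLp_toGrad_μ
  · simp only [hv]
    exact h₁.memLp_toGrad_v.sub h₂.memLp_toGrad_v
  · intro s hs z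
    simp only [hμ]
    rw [intervalIntegral.integral_sub
      (intervalIntegrable_of_memLp (by norm_num) h₁.memLp_toGrad_μ hs)
      (intervalIntegrable_of_memLp (by norm_num) h₂.memLp_toGrad_μ hs), inner_sub_left,
      inner_sub_left, ← hg₀, ← toV0Dual_apply, toV0Dual_sub_apply, toV0Dual_sub_apply,
      h₁.toV0Dual_apply_eq hs, h₂.toV0Dual_apply_eq hs]
    ring

end TwoSolutions

/-! ### The dual norms -/

theorem normV0Dual_le {l : StrongDual ℝ (BoldV0 Ω)} {g : GradSpace Ω}
    (h : ∀ z : BoldV0 Ω, l z = inner ℝ g (toGrad Ω z)) : normV0Dual l ≤ ‖g‖ₑ := by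
  refine iSup₂_le fun z hz => ?_
  rw [normV0_eq_norm] at hz
  rw [h z]
  refine enorm_le_iff_norm_le.mpr ((norm_inner_le_norm _ _).trans ?_)
  exact mul_le_of_le_one_right (norm_nonneg _) hz

theorem abs_apply_le_normV0Dual_mul {l : StrongDual ℝ (BoldV0 Ω)} (hl : normV0Dual l ≠ ⊤)
    (z : BoldV0 Ω) : |l z| ≤ (normV0Dual l).toReal * ‖toGrad Ω z‖ := by
  have h1 : ∀ y : BoldV0 Ω, normV0 y ≤ 1 → |l y| ≤ (normV0Dual l).toReal := fun y hy => by
    have h : ‖l y‖ₑ ≤ normV0Dual l := le_iSup₂_of_le y hy le_rfl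
    simpa using ENNReal.toReal_mono hl h
  have h2 : ∀ c : ℝ, 0 ≤ c → c * ‖toGrad Ω z‖ ≤ 1 → c * |l z| ≤ (normV0Dual l).toReal :=
    fun c hc hcz => by
      have h := h1 (c • z) (by
        rwa [normV0_eq_norm, Submodule.coe_smul, map_smul, norm_smul, Real.norm_of_nonneg hc])
      rwa [map_smul, smul_eq_mul, abs_mul, abs_of_nonneg hc] at h
  rcases (norm_nonneg (toGrad Ω z)).eq_or_lt with h0 | h0
  · -- `l` is bounded on the line through `z`, so it vanishes there
    rw [← h0, mul_zero]
    refine le_of_not_gt fun hpos => ?_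
    obtain ⟨n, hn⟩ := exists_nat_gt ((normV0Dual l).toReal / |l z|)
    rw [div_lt_iff₀ hpos] at hn
    exact absurd (h2 n n.cast_nonneg (by simp [← h0])) (not_le.mpr hn)
  · have h := h2 ‖toGrad Ω z‖⁻¹ (inv_nonneg.mpr h0.le) (inv_mul_cancel₀ h0.ne').le
    rwa [inv_mul_le_iff₀ h0, mul_comm] at h

/-- Functionals of finite `𝐕₀*` norm are represented by vectors of at most that norm. -/
theorem exists_inner_toGrad_eq {l : StrongDual ℝ (BoldV0 Ω)} (hl : normV0Dual l ≠ ⊤) :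
    ∃ g : GradSpace Ω, ‖g‖ₑ ≤ normV0Dual l ∧ ∀ z : BoldV0 Ω, l z = inner ℝ g (toGrad Ω z) := by
  obtain ⟨g, hg, h⟩ := exists_inner_eq_of_le_norm
    ((toGrad Ω).comp (BoldV0 Ω).subtypeL).toLinearMap l.toLinearMap ENNReal.toReal_nonneg
    (abs_apply_le_normV0Dual_mul hl)
  refine ⟨g, ?_, h⟩
  rw [← ofReal_norm]
  exact ENNReal.ofReal_le_of_le_toReal hg

theorem intervalIntegrable_norm_inner_comp_sq {H X : Type*} [NormedAddCommGroup H]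
    [InnerProductSpace ℝ H] [NormedAddCommGroup X] [NormedSpace ℝ X] (J : X →L[ℝ] H) {f : ℝ → H}
    (hf : MemLp f 2 (volume.restrict (Ioo 0 T))) {t : ℝ} (ht : t ∈ Icc 0 T) :
    IntervalIntegrable (fun s => ‖(innerSL ℝ (f s)).comp J‖ ^ 2) volume 0 t := by
  have h : MemLp (fun s => (innerSL ℝ (f s)).comp J) 2 (volume.restrict (Ioo 0 T)) := by
    refine hf.of_le_mul (c := ‖J‖) (((innerSL ℝ).continuous.clm_comp
      continuous_const).comp_aestronglyMeasurable hf.aestronglyMeasurable)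
      (Filter.Eventually.of_forall fun s => ?_)
    refine (ContinuousLinearMap.opNorm_comp_le _ _).trans_eq ?_
    rw [innerSL_apply_norm, mul_comm]
  exact intervalIntegrable_of_memLp le_rfl (memLp_one_iff_integrable.mpr
    (h.integrable_norm_pow (by norm_num))) ht

theorem intervalIntegrable_norm_hToVDual_sq {f : ℝ → BoldH Ω}
    (hf : MemLp f 2 (volume.restrict (Ioo 0 T))) {t : ℝ} (ht : t ∈ Icc 0 T) :
    IntervalIntegrable (fun s => ‖hToVDual (f s)‖ ^ 2) volume 0 t :=
  intervalIntegrable_norm_inner_comp_sq _ hf ht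

theorem lintegral_Ioc_ofReal {p : ℝ → ℝ} {t : ℝ} (ht : 0 ≤ t)
    (hp : IntervalIntegrable p volume 0 t) (hp0 : ∀ s, 0 ≤ p s) :
    ∫⁻ s in Ioc 0 t, ENNReal.ofReal (p s) = ENNReal.ofReal (∫ s in (0 : ℝ)..t, p s) := by
  rw [intervalIntegral.integral_of_le ht, ofReal_integral_eq_lintegral_ofReal
    ((intervalIntegrable_iff_integrableOn_Ioc_of_le ht).mp hp) (Filter.Eventually.of_forall hp0)]

theorem lintegral_Ioc_enorm_sq {Y : Type*} [SeminormedAddCommGroup Y] {y : ℝ → Y} {t : ℝ}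
    (ht : 0 ≤ t) (hy : IntervalIntegrable (fun s => ‖y s‖ ^ 2) volume 0 t) :
    ∫⁻ s in Ioc 0 t, ‖y s‖ₑ ^ 2 = ENNReal.ofReal (∫ s in (0 : ℝ)..t, ‖y s‖ ^ 2) := by
  rw [← lintegral_Ioc_ofReal ht hy fun _ => by positivity]
  refine lintegral_congr fun s => ?_
  rw [ENNReal.ofReal_pow (norm_nonneg _), ofReal_norm]

/-- Passage from an estimate between real numbers to extended non-negative reals. -/
theorem sq_add_ofReal_le_of_real {G : Type*} [SeminormedAddCommGroup G] {g g₀ : G}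
    {D D₀ P' F' : ℝ≥0∞} {P F e e' k : ℝ} (hD : D ≤ ‖g‖ₑ) (hD₀ : ‖g₀‖ₑ ≤ D₀) (hP : 0 ≤ P) (hF : 0 ≤ F)
    (hP' : P' = ENNReal.ofReal P) (hF' : F' = ENNReal.ofReal F)
    (he' : 0 ≤ e') (hee' : e ≤ e') (hk : 0 ≤ k) (h : ‖g‖ ^ 2 + P ≤ e * (‖g₀‖ ^ 2 + k * F)) :
    D ^ 2 + P' ≤ ENNReal.ofReal (e' * max 1 k) * (D₀ ^ 2 + F') := by
  subst hP' hF'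
  have hm : (0 : ℝ) < max 1 k := lt_max_of_lt_left one_pos
  have hreal : ‖g‖ ^ 2 + P ≤ e' * max 1 k * (‖g₀‖ ^ 2 + F) := by
    refine h.trans ?_
    rw [mul_assoc]
    refine mul_le_mul hee' ?_ (by positivity) he'
    rw [mul_add]
    exact add_le_add (le_mul_of_one_le_left (sq_nonneg _) (le_max_left _ _))
      (mul_le_mul_of_nonneg_right (le_max_right _ _) hF)
  have e3 : ∀ h : G, ‖h‖ₑ ^ 2 = ENNReal.ofReal (‖h‖ ^ 2) := fun h => by
    rw [ENNReal.ofReal_pow (norm_nonneg _), ofReal_norm]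
  calc D ^ 2 + ENNReal.ofReal P ≤ ENNReal.ofReal (‖g‖ ^ 2) + ENNReal.ofReal P := by
        rw [← e3]
        gcongr
    _ ≤ ENNReal.ofReal (e' * max 1 k) * (ENNReal.ofReal (‖g₀‖ ^ 2) + ENNReal.ofReal F) := by
        rw [← ENNReal.ofReal_add (sq_nonneg _) hP, ← ENNReal.ofReal_add (sq_nonneg _) hF,
          ← ENNReal.ofReal_mul (mul_nonneg he' hm.le)]
        exact ENNReal.ofReal_le_ofReal hreal
    _ ≤ _ := by
        rw [← e3]
        gcongr

/-- The forcing term, absorbed with Young's inequality and the Poincaré inequality. -/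
theorem two_mul_inner_toH_le {c : ℝ} (hc : IsPoincareConst Ω c) (f : BoldH Ω) (z : BoldV0 Ω) :
    2 * inner ℝ f (toH Ω z) ≤ 1 / 2 * ‖toGrad Ω z‖ ^ 2 + 2 / c * ‖hToVDual f‖ ^ 2 := by
  have h1 : hToVDual f ⟨z, z.2.1⟩ ≤ ‖hToVDual f‖ * ‖z‖ :=
    (le_abs_self _).trans ((hToVDual f).le_opNorm ⟨z, z.2.1⟩)
  rw [hToVDual_apply] at h1
  have h2 := hc.2 z
  rw [normV0_eq_norm] at h2
  -- Young's inequality with the weight for which `c ‖z‖² ≤ ‖∇z‖²` leaves `‖∇z‖² / 2`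
  have h3 : 0 ≤ 2 / c * (‖hToVDual f‖ - c / 2 * ‖z‖) ^ 2 :=
    mul_nonneg (div_nonneg zero_le_two hc.1.le) (sq_nonneg _)
  have h4 : 2 / c * (‖hToVDual f‖ - c / 2 * ‖z‖) ^ 2
      = 2 / c * ‖hToVDual f‖ ^ 2 - 2 * (‖hToVDual f‖ * ‖z‖) + c / 2 * ‖z‖ ^ 2 := by
    have := hc.1.ne'
    field_simp
    ring
  dsimp only at h1
  linarith

/-! ### The continuous dependence estimate -/

section TwoSolutions

variable {b bΓ : ℝ → ℝ≥0∞} {π πΓ : ℝ → ℝ} {L LΓ : ℝ≥0} {m₀ : ℝ} {f₁ f₂ : ℝ → BoldH Ω}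
  {v₀₁ v₀₂ : BoldV0 Ω} {v₁ v₂ : ℝ → BoldV0 Ω} {μ₁ μ₂ : ℝ → BoldV Ω} {ξ₁ ξ₂ : ℝ → BoldH Ω}

/-- Uniqueness needs no Poincaré inequality: with equal data the energy estimate holds with
`g₀ = 0` and `q = 0`. -/
theorem IsWeakSolution.toH_eq (hΩ : IsSmoothBoundedDomain Ω)
    (hπ : LipschitzWith L π) (hπΓ : LipschitzWith LΓ πΓ)
    (h₁ : IsWeakSolution Ω T (subdiff b) (subdiff bΓ) π πΓ f₁ m₀ v₀₁ v₁ μ₁ ξ₁)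
    (h₂ : IsWeakSolution Ω T (subdiff b) (subdiff bΓ) π πΓ f₂ m₀ v₀₂ v₂ μ₂ ξ₂)
    (hf : ∀ᵐ s ∂(volume.restrict (Ioo 0 T)), f₁ s = f₂ s) (hv : toH Ω v₀₁ = toH Ω v₀₂)
    {t : ℝ} (ht : t ∈ Icc 0 T) : toH Ω (v₁ t) = toH Ω (v₂ t) := by
  obtain ⟨-, g, hg, hle⟩ := h₁.energy_estimate hΩ hπ hπΓ h₂ (g₀ := 0) (q := fun _ => 0)
    (fun z => by
      rw [toV0Dual_sub_apply, toV0Dual_apply, toV0Dual_apply, hv, sub_self, inner_zero_left])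
    ht intervalIntegrable_const (fun _ => le_rfl) (by
      filter_upwards [hf] with s hs
      rw [hs, sub_self, inner_zero_left, mul_zero, add_zero]
      positivity)
  have hI : 0 ≤ ∫ s in (0 : ℝ)..t, ‖toGrad Ω (v₁ s - v₂ s : BoldV0 Ω)‖ ^ 2 :=
    intervalIntegral.integral_nonneg ht.1 fun _ _ => by positivity
  rw [norm_zero, intervalIntegral.integral_zero, zero_pow two_ne_zero, add_zero, mul_zero] at hle
  have hg0 : ‖g‖ = 0 := pow_eq_zero_iff two_ne_zero |>.mp (le_antisymm (by linarith) (sq_nonneg _))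
  have h0 := hg (v₁ t - v₂ t)
  rw [norm_eq_zero.mp hg0, inner_zero_left, toV0Dual_apply, inner_self_eq_zero,
    Submodule.coe_sub, map_sub, sub_eq_zero] at h0
  exact h0

/-- In the constant, the exponential comes from Grönwall's lemma and `2 / c` from Young's inequality
for the source term; `T` replaces `t` to make it uniform in time. -/
theorem IsWeakSolution.continuous_dependence (hΩ : IsSmoothBoundedDomain Ω)
    (hπ : LipschitzWith L π) (hπΓ : LipschitzWith LΓ πΓ)
    (hf₁ : MemLp f₁ 2 (volume.restrict (Ioo 0 T))) (hf₂ : MemLp f₂ 2 (volume.restrict (Ioo 0 T)))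
    (h₁ : IsWeakSolution Ω T (subdiff b) (subdiff bΓ) π πΓ f₁ m₀ v₀₁ v₁ μ₁ ξ₁)
    (h₂ : IsWeakSolution Ω T (subdiff b) (subdiff bΓ) π πΓ f₂ m₀ v₀₂ v₂ μ₂ ξ₂)
    {c : ℝ} (hc : IsPoincareConst Ω c) {t : ℝ} (ht : t ∈ Icc 0 T) :
    normV0Dual (toV0Dual (v₁ t - v₂ t)) ^ 2
        + ∫⁻ s in Ioc 0 t, ENNReal.ofReal (normV0 (v₁ s - v₂ s) ^ 2)
      ≤ ENNReal.ofReal (Real.exp (2 * max (L : ℝ) LΓ ^ 2 * T) * max 1 (2 / c)) *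
        (normV0Dual (toV0Dual (v₀₁ - v₀₂)) ^ 2
          + ∫⁻ s in Ioc 0 t, ‖hToVDual (f₁ s - f₂ s)‖ₑ ^ 2) := by
  -- if the initial values have infinite distance the right-hand side is infinite
  by_cases htop : normV0Dual (toV0Dual (v₀₁ - v₀₂)) = ⊤
  · have hC : 0 < Real.exp (2 * max (L : ℝ) LΓ ^ 2 * T) * max 1 (2 / c) :=
      mul_pos (Real.exp_pos _) (lt_max_of_lt_left one_pos)
    rw [htop, ENNReal.top_pow two_ne_zero, top_add, ENNReal.mul_top (ENNReal.ofReal_pos.mpr hC).ne']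
    exact le_top
  obtain ⟨g₀, hg₀n, hg₀⟩ := exists_inner_toGrad_eq htop
  have hF := intervalIntegrable_norm_hToVDual_sq (hf₁.sub hf₂) ht
  simp only [Pi.sub_apply] at hF
  have hc0 : 0 ≤ 2 / c := div_nonneg zero_le_two hc.1.le
  obtain ⟨hpi, g, hg, hle⟩ := h₁.energy_estimate hΩ hπ hπΓ h₂ hg₀ ht (hF.const_mul (2 / c))
    (fun s => mul_nonneg hc0 (sq_nonneg _))
    (Filter.Eventually.of_forall fun s => two_mul_inner_toH_le hc _ _)
  rw [intervalIntegral.integral_const_mul] at hle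
  have e1 : ∫⁻ s in Ioc 0 t, ENNReal.ofReal (normV0 (v₁ s - v₂ s) ^ 2)
      = ENNReal.ofReal (∫ s in (0 : ℝ)..t, ‖toGrad Ω (v₁ s - v₂ s : BoldV0 Ω)‖ ^ 2) := by
    simp only [normV0_eq_norm]
    exact lintegral_Ioc_ofReal ht.1 hpi fun _ => sq_nonneg _
  have e2 : ∫⁻ s in Ioc 0 t, ‖hToVDual (f₁ s - f₂ s)‖ₑ ^ 2
      = ENNReal.ofReal (∫ s in (0 : ℝ)..t, ‖hToVDual (f₁ s - f₂ s)‖ ^ 2) :=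
    lintegral_Ioc_enorm_sq ht.1 hF
  exact sq_add_ofReal_le_of_real (normV0Dual_le hg) hg₀n
    (intervalIntegral.integral_nonneg ht.1 fun _ _ => sq_nonneg _)
    (intervalIntegral.integral_nonneg ht.1 fun _ _ => sq_nonneg _) e1 e2 (Real.exp_pos _).le
    (Real.exp_le_exp.mpr (mul_le_mul_of_nonneg_left ht.2 (by positivity))) hc0 hle

end TwoSolutions

end CahnHilliard

theorem theorem2p1 :
    ∃ C : ℝ → ℝ≥0 → ℝ≥0 → ℝ → ℝ≥0,
      (∀ (cp : ℝ) (L LΓ : ℝ≥0) (T : ℝ), 0 < C cp L LΓ T) ∧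
      ∀ (d : ℕ) (_ : d = 2 ∨ d = 3) (Ω : Set (CahnHilliard.E d))
        (_ : CahnHilliard.IsSmoothBoundedDomain Ω)
        (T : ℝ) (_ : 0 < T)
        (b bΓ : ℝ → ℝ≥0∞) (_ : CahnHilliard.IsConvexPotential b)
        (_ : CahnHilliard.IsConvexPotential bΓ)
        (π πΓ : ℝ → ℝ) (L LΓ : ℝ≥0) (_ : LipschitzWith L π) (_ : LipschitzWith LΓ πΓ)
        (m₀ : ℝ) (f₁ f₂ : ℝ → CahnHilliard.BoldH Ω)
        (_ : MemLp f₁ 2 (volume.restrict (Ioo 0 T)))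
        (_ : MemLp f₂ 2 (volume.restrict (Ioo 0 T)))
        (v₀₁ v₀₂ : CahnHilliard.BoldV0 Ω)
        (v₁ v₂ : ℝ → CahnHilliard.BoldV0 Ω) (μ₁ μ₂ : ℝ → CahnHilliard.BoldV Ω)
        (ξ₁ ξ₂ : ℝ → CahnHilliard.BoldH Ω)
        (_ : CahnHilliard.IsWeakSolution Ω T (CahnHilliard.subdiff b) (CahnHilliard.subdiff bΓ)
          π πΓ f₁ m₀ v₀₁ v₁ μ₁ ξ₁)
        (_ : CahnHilliard.IsWeakSolution Ω T (CahnHilliard.subdiff b) (CahnHilliard.subdiff bΓ)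
          π πΓ f₂ m₀ v₀₂ v₂ μ₂ ξ₂),
        (∀ cp : ℝ, CahnHilliard.IsPoincareConst Ω cp → ∀ t ∈ Icc 0 T,
          CahnHilliard.normV0Dual (CahnHilliard.toV0Dual (v₁ t - v₂ t)) ^ 2
            + ∫⁻ s in Ioc 0 t, ENNReal.ofReal (CahnHilliard.normV0 (v₁ s - v₂ s) ^ 2)
          ≤ (C cp L LΓ T : ℝ≥0∞) *
            (CahnHilliard.normV0Dual (CahnHilliard.toV0Dual (v₀₁ - v₀₂)) ^ 2
              + ∫⁻ s in Ioc 0 t, ‖CahnHilliard.hToVDual (f₁ s - f₂ s)‖ₑ ^ 2)) ∧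
        ((∀ᵐ s ∂(volume.restrict (Ioo 0 T)), f₁ s = f₂ s) →
          CahnHilliard.toH Ω v₀₁ = CahnHilliard.toH Ω v₀₂ →
          ∀ t ∈ Icc 0 T, CahnHilliard.toH Ω (v₁ t) = CahnHilliard.toH Ω (v₂ t)) := by
  refine ⟨fun cp L LΓ T => (Real.exp (2 * max (L : ℝ) LΓ ^ 2 * T) * max 1 (2 / cp)).toNNReal,
    fun cp L LΓ T => Real.toNNReal_pos.mpr
      (mul_pos (Real.exp_pos _) (lt_max_of_lt_left one_pos)), ?_⟩
  intro d _ Ω hΩ T _ b bΓ _ _ π πΓ L LΓ hπ hπΓ m₀ f₁ f₂ hf₁ hf₂ v₀₁ v₀₂ v₁ v₂ μ₁ μ₂ ξ₁ ξ₂ h₁ h₂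
  exact ⟨fun cp hcp t ht => h₁.continuous_dependence hΩ hπ hπΓ hf₁ hf₂ h₂ hcp ht,
    fun hf hv t ht => h₁.toH_eq hΩ hπ hπΓ h₂ hf hv ht⟩
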